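/- **Theorem.** Let $n\ge 1$ and let $H=([n],E)$ be a hypergraph on $[n]=\{1,\dots,n\}$ all of whose edges have at least two elements and no edge of which is properly contained in another. *Definitions.* Order the ordered set partitions $B_1|\cdots|B_r$ of $[n]$ (without empty blocks) by letting $B$ cover the partitions obtained from it by uniting two adjacent blocks. Let $\Sigma_n$ be the simplicial complex whose $(r-2)$-dimensional faces are all the ordered set partitions $B_1|\cdots|B_r$ of $[n]$, with containment of faces given by this order, and let the hypergraph coloring complex $\Delta_H\subseteq\Sigma_n$ consist of those faces $B_1|\cdots|B_r$ for which some block $B_i$ contains an edge of $H$. Let $K_n$ be the complete graph on $[n]$, regarded as a hypergraph with the two-element subsets as edges. Let $I_H\subseteq\mathbb{R}[x_1,\dots,x_n]$ be the edge ideal, generated by the monomials $\prod_{i\in F}x_i$, $F\in E$, and let $\mathcal{A}_H$ be its canonical arrangement: the collection of the subspaces $\{u : u_{i_1}=\cdots=u_{i_s},\ u_1+\cdots+u_n=0\}$ of $\mathbb{R}^n$, one for each square-free minimal monomial generator $x_{i_1}\cdots x_{i_s}$ of $I_H$ (we also write $\mathcal{A}_H$ for their union). Let $S^{n-2}$ be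 the unit sphere of the hyperplane $\{u\in\mathbb{R}^n : u_1+\cdots+u_n=0\}$. The braid arrangement $\mathcal{A}_n=\{\{u_i=u_j\} : i\ne j\}$ subdivides $S^{n-2}$ into cells, the intersections of $S^{n-2}$ with the closed faces of $\mathcal{A}_n$; the restriction of this subdivision to $\mathcal{A}_H$ consists of the cells that are contained in $\mathcal{A}_H$. *Claims.* 1. The cells of the restriction of the subdivision $\mathcal{A}_n\cap S^{n-2}$ to $\mathcal{A}_H$ are spherical simplices, and the simplicial complex they form is isomorphic to $\Delta_H$. 2. $\Sigma_n$ is simplicially isomorphic to the barycentric subdivision of the boundary of the $(n-1)$-simplex, $\Delta_H\subseteq\Delta_{K_n}\subseteq\Sigma_n$, and there is a homeomorphism from (the geometric realization of) $\Sigma_n$ onto $S^{n-2}$ that maps $\Delta_H$ onto $S^{n-2}\cap\mathcal{A}_H$ and $\Delta_{K_n}$ onto $S^{n-2}\cap\mathcal{A}_{K_n}$. In particular the pair $(\Sigma_n,\Delta_H)$ is homeomorphic to the pair $(S^{n-2},S^{n-2}\cap\mathcal{A}_H)$, and the pair $(\Delta_{K_n},\Delta_H)$ to the pair $(S^{n-2}\cap\mathcal{A}_{K_n},S^{n-2}\cap\mathcal{A}_H)$.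 -/

import Mathlib

/-! ### Ordered set partitions -/

/-- An ordered set partition `B₁|B₂|⋯|B_r` of the `n`-element set `Fin n`, without empty blocks. -/
@[ext]
structure OrderedSetPartition (n : ℕ) where
  blocks : List (Finset (Fin n))
  nonempty_of_mem : ∀ b ∈ blocks, b.Nonempty
  disjoint : blocks.Pairwise Disjoint
  cover : ∀ i : Fin n, ∃ b ∈ blocks, i ∈ b

namespace OrderedSetPartition

/-- `B'` arises from `B` by taking the union of two adjacent blocks. -/
def Merges {n : ℕ} (B' B : OrderedSetPartition n) : Prop :=
  ∃ (l₁ l₂ : List (Finset (Fin n))) (x y : Finset (Fin n)),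
    B.blocks = l₁ ++ x :: y :: l₂ ∧ B'.blocks = l₁ ++ (x ∪ y) :: l₂

/-- The order on ordered set partitions generated by: `B` lies above every partition that is
obtained from it by uniting two adjacent blocks. -/
instance (n : ℕ) : Preorder (OrderedSetPartition n) where
  le := Relation.ReflTransGen Merges
  le_refl _ := Relation.ReflTransGen.refl
  le_trans _ _ _ := Relation.ReflTransGen.trans

/-- The ordered set partitions with exactly two blocks. -/
abbrev TwoBlock (n : ℕ) : Type := {v : OrderedSetPartition n // v.blocks.length = 2}

/-- The union of a list of blocks. -/
def union {n : ℕ} (l : List (Finset (Fin n))) : Finset (Fin n) := l.foldr (· ∪ ·) ∅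

theorem union_append {n : ℕ} (l m : List (Finset (Fin n))) :
    union (l ++ m) = union l ∪ union m := by
  induction l with
  | nil => simp [union]
  | cons a l ih =>
    have h : ∀ (a : Finset (Fin n)) l, union (a :: l) = a ∪ union l := fun _ _ => rfl
    rw [List.cons_append, h, h, ih, Finset.union_assoc]

theorem union_cons {n : ℕ} (a : Finset (Fin n)) (l : List (Finset (Fin n))) :
    union (a :: l) = a ∪ union l := rfl

theorem mem_union {n : ℕ} {l : List (Finset (Fin n))} {i : Fin n} :
    i ∈ union l ↔ ∃ b ∈ l, i ∈ b := by
  induction l with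
  | nil => simp [union]
  | cons a l ih => simp [union_cons, ih]

/-- The partition obtained by uniting two given adjacent blocks. -/
def merge {n : ℕ} (B : OrderedSetPartition n) (l₁ l₂ : List (Finset (Fin n)))
    (x y : Finset (Fin n)) (h : B.blocks = l₁ ++ x :: y :: l₂) : OrderedSetPartition n where
  blocks := l₁ ++ (x ∪ y) :: l₂
  nonempty_of_mem := by
    intro b hb
    have H := B.nonempty_of_mem
    rw [h] at H
    simp only [List.mem_append, List.mem_cons] at hb H
    rcases hb with hb | rfl | hb
    · exact H b (Or.inl hb)
    · exact (H x (Or.inr (Or.inl rfl))).mono Finset.subset_union_left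
    · exact H b (Or.inr (Or.inr (Or.inr hb)))
  disjoint := by
    have H := B.disjoint
    rw [h] at H
    simp only [List.pairwise_append, List.pairwise_cons, List.mem_cons] at H ⊢
    obtain ⟨h1, ⟨h2, h3, h4⟩, h5⟩ := H
    refine ⟨h1, ⟨fun a ha => ?_, h4⟩, fun a ha b hb => ?_⟩
    · exact Finset.disjoint_union_left.2 ⟨h2 a (Or.inr ha), h3 a ha⟩
    · rcases hb with rfl | hb
      · exact Finset.disjoint_union_right.2
          ⟨h5 a ha x (Or.inl rfl), h5 a ha y (Or.inr (Or.inl rfl))⟩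
      · exact h5 a ha b (Or.inr (Or.inr hb))
  cover := by
    intro i
    obtain ⟨b, hb, hi⟩ := B.cover i
    rw [h] at hb
    simp only [List.mem_append, List.mem_cons] at hb ⊢
    rcases hb with hb | rfl | rfl | hb
    · exact ⟨b, Or.inl hb, hi⟩
    · exact ⟨_, Or.inr (Or.inl rfl), Finset.mem_union_left _ hi⟩
    · exact ⟨_, Or.inr (Or.inl rfl), Finset.mem_union_right _ hi⟩
    · exact ⟨b, Or.inr (Or.inr hb), hi⟩

theorem merge_le {n : ℕ} (B : OrderedSetPartition n) (l₁ l₂ : List (Finset (Fin n)))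
    (x y : Finset (Fin n)) (h : B.blocks = l₁ ++ x :: y :: l₂) : B.merge l₁ l₂ x y h ≤ B :=
  Relation.ReflTransGen.single ⟨l₁, l₂, x, y, h, rfl⟩

theorem exists_split_of_le {n : ℕ} {v B : OrderedSetPartition n} (hv : v.blocks.length = 2)
    (h : v ≤ B) : ∃ p q, p ≠ [] ∧ q ≠ [] ∧ B.blocks = p ++ q ∧ v.blocks = [union p, union q] := by
  change Relation.ReflTransGen Merges v B at h
  induction h with
  | refl =>
    obtain ⟨a, b, hab⟩ := List.length_eq_two.1 hv
    exact ⟨[a], [b], by simp, by simp, by simp [hab], by simp [hab, union]⟩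
  | @tail C D _ hm ih =>
    obtain ⟨p, q, hp, hq, hC, hvb⟩ := ih
    obtain ⟨l₁, l₂, x, y, hD, hC'⟩ := hm
    rw [hC] at hC'
    rcases List.append_eq_append_iff.1 hC' with ⟨a, h1, h2⟩ | ⟨a, h1, h2⟩
    · refine ⟨p, a ++ x :: y :: l₂, hp, by simp, by simp [hD, h1], ?_⟩
      rw [hvb, h2]
      simp [union_append, union_cons, Finset.union_assoc]
    · cases a with
      | nil =>
        simp only [List.append_nil, List.nil_append] at h1 h2
        subst h1
        refine ⟨p, x :: y :: l₂, hp, by simp, hD, ?_⟩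
        rw [hvb, ← h2]
        simp [union_cons, Finset.union_assoc]
      | cons c a =>
        simp only [List.cons_append, List.cons.injEq] at h2
        obtain ⟨rfl, rfl⟩ := h2
        refine ⟨l₁ ++ x :: y :: a, q, by simp, hq, by simp [hD], ?_⟩
        rw [hvb, h1]
        simp [union_append, union_cons, Finset.union_assoc]

theorem le_of_split {n : ℕ} {v : OrderedSetPartition n} :
    ∀ (k : ℕ) (B : OrderedSetPartition n) (p q : List (Finset (Fin n))),
      B.blocks.length = k → p ≠ [] → q ≠ [] → B.blocks = p ++ q →
      v.blocks = [union p, union q] → v ≤ B := by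
  intro k
  induction k with
  | zero =>
    intro B p q hk hp hq hB hv
    rw [List.length_eq_zero_iff, hB] at hk
    simp_all
  | succ k ih =>
    intro B p q hk hp hq hB hv
    match p, q, hp, hq with
    | [a], [b], _, _ =>
      have : v = B := by
        ext1
        rw [hv, hB]; simp [union]
      exact this.le
    | a :: a' :: p, q, _, hq =>
      refine le_trans (ih (B.merge [] (p ++ q) a a' (by simp [hB])) ((a ∪ a') :: p) q ?_
        (by simp) hq (by simp [merge]) ?_) (merge_le _ _ _ _ _ _)
      · simp only [hB, merge, List.length_append, List.length_cons, List.nil_append] at hk ⊢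
        omega
      · rw [hv]; simp [union_cons, Finset.union_assoc]
    | [a], b :: b' :: q, _, _ =>
      refine le_trans (ih (B.merge [a] q b b' (by simp [hB])) [a] ((b ∪ b') :: q) ?_
        (by simp) (by simp) (by simp [merge]) ?_) (merge_le _ _ _ _ _ _)
      · simp only [hB, merge, List.length_append, List.length_cons, List.length_nil] at hk ⊢
        omega
      · rw [hv]; simp [union_cons, Finset.union_assoc]

/-- Forgetting one vertex of a partition amounts to uniting two adjacent blocks. -/
theorem exists_erase {n : ℕ} {B v : OrderedSetPartition n} (hv : v.blocks.length = 2)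
    (h : v ≤ B) : ∃ C ≤ B, ∀ w : OrderedSetPartition n, w.blocks.length = 2 →
      (w ≤ C ↔ w ≤ B ∧ w ≠ v) := by
  obtain ⟨p, q, hp, hq, hB, hvb⟩ := exists_split_of_le hv h
  obtain ⟨p, x, rfl⟩ := (List.eq_nil_or_concat p).resolve_left hp
  obtain ⟨y, q, rfl⟩ := List.exists_cons_of_ne_nil hq
  rw [List.concat_eq_append] at *
  have hB' : B.blocks = p ++ x :: y :: q := by simp [hB]
  refine ⟨B.merge p q x y hB', merge_le _ _ _ _ _ _, fun w hw => ⟨fun hwC => ?_, ?_⟩⟩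
  · refine ⟨hwC.trans (merge_le _ _ _ _ _ _), ?_⟩
    rintro rfl
    obtain ⟨p', q', hp', hq', hC, hwb⟩ := exists_split_of_le hw hwC
    have hd := B.disjoint
    rw [hB'] at hd
    simp only [List.pairwise_append, List.pairwise_cons, List.mem_cons] at hd
    obtain ⟨_, ⟨hxy, hy, _⟩, hpd⟩ := hd
    obtain ⟨i, hi⟩ := B.nonempty_of_mem x (by simp [hB'])
    obtain ⟨j, hj⟩ := B.nonempty_of_mem y (by simp [hB'])
    rw [hwb] at hvb
    simp only [List.cons.injEq, and_true] at hvb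
    obtain ⟨e1, e2⟩ := hvb
    have hip : i ∈ union p' := by
      rw [e1, mem_union]; exact ⟨x, by simp, hi⟩
    have hjp : j ∈ union q' := by
      rw [e2, mem_union]; exact ⟨y, by simp, hj⟩
    have hdC := (B.merge p q x y hB').disjoint
    rw [hC, List.pairwise_append] at hdC
    have hmem : x ∪ y ∈ p' ++ q' := by rw [← hC]; simp [merge]
    rw [mem_union] at hip hjp
    obtain ⟨b, hb, hib⟩ := hip
    obtain ⟨c, hc, hjc⟩ := hjp
    rcases List.mem_append.1 hmem with hm | hm
    · exact Finset.disjoint_left.1 (hdC.2.2 _ hm _ hc) (Finset.mem_union_right _ hj) hjc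
    · exact Finset.disjoint_left.1 (hdC.2.2 _ hb _ hm) hib (Finset.mem_union_left _ hi)
  · rintro ⟨hwB, hne⟩
    obtain ⟨p', q', hp', hq', hB2, hwb⟩ := exists_split_of_le hw hwB
    rw [hB2] at hB'
    have hcase : (∃ a, p = p' ++ a ∧ q' = a ++ x :: y :: q) ∨
        (∃ a, p' = p ++ x :: y :: a ∧ q = a ++ q') ∨ (p' = p ++ [x] ∧ q' = y :: q) := by
      rcases List.append_eq_append_iff.1 hB' with ⟨a, h1, h2⟩ | ⟨a, h1, h2⟩
      · exact Or.inl ⟨a, h1, h2⟩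
      · match a, h1, h2 with
        | [], h1, h2 => exact Or.inl ⟨[], by simp [h1], by simpa using h2.symm⟩
        | [c], h1, h2 =>
          simp only [List.cons_append, List.nil_append, List.cons.injEq] at h2
          exact Or.inr (Or.inr ⟨by rw [h1, h2.1], h2.2.symm⟩)
        | c :: d :: a, h1, h2 =>
          simp only [List.cons_append, List.cons.injEq] at h2
          exact Or.inr (Or.inl ⟨a, by rw [h1, h2.1, h2.2.1], h2.2.2⟩)
    rcases hcase with ⟨a, rfl, rfl⟩ | ⟨a, rfl, rfl⟩ | ⟨rfl, rfl⟩
    · refine le_of_split _ _ p' (a ++ (x ∪ y) :: q) rfl hp' (by simp) (by simp [merge]) ?_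
      rw [hwb]; simp [union_append, union_cons, Finset.union_assoc]
    · refine le_of_split _ _ (p ++ (x ∪ y) :: a) q' rfl (by simp) hq' (by simp [merge]) ?_
      rw [hwb]; simp [union_append, union_cons, Finset.union_assoc]
    · exact absurd (OrderedSetPartition.ext (hwb.trans hvb.symm)) hne

end OrderedSetPartition

open OrderedSetPartition in
/-- The simplicial complex whose faces are the ordered set partitions in a lower set `I`, contained
in each other according to the order on ordered set partitions. A face `B₁|⋯|B_r` is encoded by its
set of vertices, the `r - 1` two-block partitions below it; the one-block partition is the empty
face, which `PreAbstractSimplicialComplex` does not list. -/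
def partitionComplex {n : ℕ} (I : LowerSet (OrderedSetPartition n)) :
    PreAbstractSimplicialComplex (TwoBlock n) where
  faces := {s | s.Nonempty ∧ ∃ B ∈ I, ∀ v : TwoBlock n, v ∈ s ↔ v.1 ≤ B}
  isRelLowerSet_faces := by
    classical
    rintro s ⟨hs, hB⟩
    refine ⟨hs, fun t hts ht => ⟨ht, ?_⟩⟩
    obtain ⟨k, hk⟩ : ∃ k, (s \ t).card = k := ⟨_, rfl⟩
    induction k generalizing s with
    | zero =>
      have : s = t := Finset.Subset.antisymm
        (Finset.sdiff_eq_empty_iff_subset.1 (Finset.card_eq_zero.1 hk)) hts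
      exact this ▸ hB
    | succ k ih =>
      obtain ⟨v, hv⟩ : (s \ t).Nonempty := Finset.card_pos.1 (by omega)
      obtain ⟨hvs, hvt⟩ := Finset.mem_sdiff.1 hv
      obtain ⟨B, hBI, hB⟩ := hB
      obtain ⟨C, hCB, hC⟩ := exists_erase v.2 ((hB v).1 hvs)
      have hsub : t ⊆ s.erase v := fun w hw =>
        Finset.mem_erase.2 ⟨fun h => hvt (h ▸ hw), hts hw⟩
      refine ih (s := s.erase v) (ht.mono hsub)
        ⟨C, I.lower hCB hBI, fun w => ?_⟩ hsub ?_
      · rw [hC w.1 w.2, Finset.mem_erase, hB w, and_comm, Ne, Ne, Subtype.ext_iff]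
      · rw [Finset.erase_sdiff_comm, Finset.card_erase_of_mem hv, hk]; rfl

/-- The complex of all ordered set partitions. -/
def orderedPartitionComplex (n : ℕ) :
    PreAbstractSimplicialComplex (OrderedSetPartition.TwoBlock n) :=
  partitionComplex ⊤

/-- The barycentric subdivision of the boundary of the simplex with vertex set `Fin n`: its faces
are the chains of nonempty proper subsets. -/
def sdBoundarySimplex (n : ℕ) : PreAbstractSimplicialComplex (Finset (Fin n)) where
  faces := {s | s.Nonempty ∧ (∀ A ∈ s, A.Nonempty ∧ A ≠ Finset.univ) ∧
    IsChain (· ⊆ ·) (s : Set (Finset (Fin n)))}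
  isRelLowerSet_faces := by
    rintro s ⟨hs, h1, h2⟩
    exact ⟨hs, fun t hts ht =>
      ⟨ht, fun A hA => h1 A (hts hA), h2.mono (Finset.coe_subset.2 hts)⟩⟩

/-! ### The coloring complex of a hypergraph -/

/-- The ordered set partitions having a block that contains an edge of `H`. -/
def coloringIdeal {n : ℕ} (H : Hypergraph (Fin n)) : LowerSet (OrderedSetPartition n) where
  carrier := {B | ∃ b ∈ B.blocks, ∃ e ∈ H.edgeSet, e ⊆ (b : Set (Fin n))}
  lower' := by
    intro B C hCB hB
    change Relation.ReflTransGen OrderedSetPartition.Merges C B at hCB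
    induction hCB with
    | refl => exact hB
    | tail _ hm ih =>
      obtain ⟨l₁, l₂, x, y, hD, hC⟩ := hm
      obtain ⟨b, hb, e, he, heb⟩ := hB
      apply ih
      rw [hD] at hb
      simp only [List.mem_append, List.mem_cons] at hb
      simp only [Set.mem_ofPred_eq, hC, List.mem_append, List.mem_cons]
      rcases hb with hb | rfl | rfl | hb
      · exact ⟨b, Or.inl hb, e, he, heb⟩
      · exact ⟨_, Or.inr (Or.inl rfl), e, he,
          heb.trans (Finset.coe_subset.2 Finset.subset_union_left)⟩
      · exact ⟨_, Or.inr (Or.inl rfl), e, he,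
          heb.trans (Finset.coe_subset.2 Finset.subset_union_right)⟩
      · exact ⟨b, Or.inr (Or.inr hb), e, he, heb⟩

/-- The hypergraph coloring complex: its faces are the ordered set partitions having a block that
contains an edge. -/
def coloringComplex {n : ℕ} (H : Hypergraph (Fin n)) :
    PreAbstractSimplicialComplex (OrderedSetPartition.TwoBlock n) :=
  partitionComplex (coloringIdeal H)

/-- The complete graph on `Fin n`, as a hypergraph. -/
def completeGraphHypergraph (n : ℕ) : Hypergraph (Fin n) where
  vertexSet := Set.univ
  edgeSet := {e | e.ncard = 2}
  subset_vertexSet_of_mem_edgeSet' := fun _ _ => Set.subset_univ _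

/-! ### Isomorphism and geometric realization of simplicial complexes -/

/-- The vertices of a simplicial complex. -/
abbrev PreAbstractSimplicialComplex.Vertex {α : Type*} (K : PreAbstractSimplicialComplex α) :
    Type _ := {v : α // {v} ∈ K.faces}

/-- Two simplicial complexes are isomorphic: there is a bijection between their vertices under
which the faces correspond to each other. -/
def SimpliciallyIsomorphic {α β : Type*} (K : PreAbstractSimplicialComplex α)
    (L : PreAbstractSimplicialComplex β) : Prop :=
  ∃ φ : K.Vertex ≃ L.Vertex, ∀ s : Finset K.Vertex,
    s.map (Function.Embedding.subtype _) ∈ K.faces ↔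
      (s.map φ.toEmbedding).map (Function.Embedding.subtype _) ∈ L.faces

/-- The geometric realization of a simplicial complex with finitely many vertices, in barycentric
coordinates, with the topology induced from `α → ℝ`. -/
def geometricRealization {α : Type*} (K : PreAbstractSimplicialComplex α) : Set (α → ℝ) :=
  {w | ∃ s ∈ K.faces, (∀ v, 0 ≤ w v) ∧ (∀ v ∉ s, w v = 0) ∧ ∑ v ∈ s, w v = 1}

/-! ### The edge ideal and its canonical arrangement -/

/-- The square-free monomial `x^A`. -/
noncomputable def squarefreeMonomial {n : ℕ} (A : Finset (Fin n)) : MvPolynomial (Fin n) ℝ :=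
  ∏ i ∈ A, MvPolynomial.X i

/-- The edge ideal of a hypergraph. -/
noncomputable def edgeIdeal {n : ℕ} (H : Hypergraph (Fin n)) : Ideal (MvPolynomial (Fin n) ℝ) :=
  Ideal.span {m | ∃ F : Finset (Fin n), (F : Set (Fin n)) ∈ H.edgeSet ∧ m = squarefreeMonomial F}

/-- `x^A` is a minimal generator of the monomial ideal `J`: it lies in `J`, but none of its proper
monomial divisors (which are the `x^B` with `B ⊂ A`) does. -/
def IsSquarefreeMinimalGenerator {n : ℕ} (J : Ideal (MvPolynomial (Fin n) ℝ))
    (A : Finset (Fin n)) : Prop :=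
  squarefreeMonomial A ∈ J ∧ ∀ B, B ⊂ A → squarefreeMonomial B ∉ J

/-- The hyperplane `u₁ + ⋯ + u_n = 0`. -/
def sumZeroHyperplane (n : ℕ) : Submodule ℝ (EuclideanSpace ℝ (Fin n)) where
  carrier := {u | ∑ i, u i = 0}
  add_mem' := by
    intro a b ha hb
    simp only [Set.mem_ofPred_eq, PiLp.add_apply, Finset.sum_add_distrib] at *
    rw [ha, hb, add_zero]
  zero_mem' := by simp
  smul_mem' := by
    intro c a ha
    simp only [Set.mem_ofPred_eq, PiLp.smul_apply, smul_eq_mul, ← Finset.mul_sum] at *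
    rw [ha, mul_zero]

/-- The subspace on which all coordinates with index in `A` agree. -/
def diagonalSubspace {n : ℕ} (A : Finset (Fin n)) : Submodule ℝ (EuclideanSpace ℝ (Fin n)) where
  carrier := {u | ∀ i ∈ A, ∀ j ∈ A, u i = u j}
  add_mem' := by
    intro a b ha hb i hi j hj
    simp only [PiLp.add_apply]
    rw [ha i hi j hj, hb i hi j hj]
  zero_mem' := by simp
  smul_mem' := by
    intro c a ha i hi j hj
    simp only [PiLp.smul_apply]
    rw [ha i hi j hj]

/-- The canonical arrangement of a monomial ideal: the collection of the subspaces belonging to its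
square-free minimal generators, intersected with the sum-zero hyperplane. -/
def canonicalArrangement {n : ℕ} (J : Ideal (MvPolynomial (Fin n) ℝ)) :
    Set (Submodule ℝ (EuclideanSpace ℝ (Fin n))) :=
  {W | ∃ A, IsSquarefreeMinimalGenerator J A ∧ W = diagonalSubspace A ⊓ sumZeroHyperplane n}

/-- The union of the subspaces of the canonical arrangement of the edge ideal of `H`. -/
def hypergraphArrangement {n : ℕ} (H : Hypergraph (Fin n)) : Set (EuclideanSpace ℝ (Fin n)) :=
  ⋃ W ∈ canonicalArrangement (edgeIdeal H), (W : Set (EuclideanSpace ℝ (Fin n)))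

/-! ### The subdivision of the sphere by the braid arrangement -/

/-- The unit sphere (of dimension `n - 2`) in the sum-zero hyperplane. -/
def sumZeroSphere (n : ℕ) : Set (EuclideanSpace ℝ (Fin n)) :=
  {u | u ∈ sumZeroHyperplane n ∧ ‖u‖ = 1}

/-- The closed face of the braid arrangement that has `x` in its relative interior: the points
that lie, for every hyperplane `u i = u j`, on the hyperplane if `x` does, and otherwise in the
closed half-space bounded by it that contains `x`. -/
def braidFace {n : ℕ} (x : EuclideanSpace ℝ (Fin n)) : Set (EuclideanSpace ℝ (Fin n)) :=
  {y | ∀ i j, (x i = x j → y i = y j) ∧ (x i < x j → y i ≤ y j)}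

/-- The nonempty closed cells of the subdivision of the sphere by the braid arrangement. -/
def braidCells (n : ℕ) : Set (Set (EuclideanSpace ℝ (Fin n))) :=
  {C | ∃ x ∈ sumZeroSphere n, C = braidFace x ∩ sumZeroSphere n}

/-- The points of the sphere that are nonnegative linear combinations of the points in `s`. -/
def sphericalHull {n : ℕ} (s : Finset (EuclideanSpace ℝ (Fin n))) :
    Set (EuclideanSpace ℝ (Fin n)) :=
  {y | y ∈ sumZeroSphere n ∧
    ∃ c : EuclideanSpace ℝ (Fin n) → ℝ, (∀ v ∈ s, 0 ≤ c v) ∧ y = ∑ v ∈ s, c v • v}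

/-- `C` is the spherical simplex with vertex set `s`. -/
def IsSphericalSimplex {n : ℕ} (s : Finset (EuclideanSpace ℝ (Fin n)))
    (C : Set (EuclideanSpace ℝ (Fin n))) : Prop :=
  s.Nonempty ∧ (∀ v ∈ s, v ∈ sumZeroSphere n) ∧
    LinearIndepOn ℝ id (s : Set (EuclideanSpace ℝ (Fin n))) ∧ C = sphericalHull s

theorem braidFace_subset {n : ℕ} {x x' : EuclideanSpace ℝ (Fin n)} (h : x' ∈ braidFace x) :
    braidFace x' ⊆ braidFace x := by
  intro y hy i j
  refine ⟨fun hij => (hy i j).1 ((h i j).1 hij), fun hij => ?_⟩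
  rcases ((h i j).2 hij).lt_or_eq with h' | h'
  · exact (hy i j).2 h'
  · exact ((hy i j).1 h').le

theorem smul_mem_braidFace {n : ℕ} {x y : EuclideanSpace ℝ (Fin n)} {c : ℝ} (hc : 0 ≤ c)
    (h : y ∈ braidFace x) : c • y ∈ braidFace x := by
  intro i j
  simp only [PiLp.smul_apply, smul_eq_mul]
  exact ⟨fun hij => by rw [(h i j).1 hij],
    fun hij => mul_le_mul_of_nonneg_left ((h i j).2 hij) hc⟩

theorem sum_mem_braidFace {n : ℕ} {x : EuclideanSpace ℝ (Fin n)}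
    {s : Finset (EuclideanSpace ℝ (Fin n))} {c : EuclideanSpace ℝ (Fin n) → ℝ}
    (hc : ∀ v ∈ s, 0 ≤ c v) (h : ∀ v ∈ s, v ∈ braidFace x) :
    ∑ v ∈ s, c v • v ∈ braidFace x := by
  intro i j
  simp only [WithLp.ofLp_sum, Finset.sum_apply, PiLp.smul_apply, smul_eq_mul]
  exact ⟨fun hij => Finset.sum_congr rfl fun v hv => by rw [(h v hv i j).1 hij],
    fun hij => Finset.sum_le_sum fun v hv =>
      mul_le_mul_of_nonneg_left ((h v hv i j).2 hij) (hc v hv)⟩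

theorem exists_coeff {n : ℕ} {x z : EuclideanSpace ℝ (Fin n)}
    {s : Finset (EuclideanSpace ℝ (Fin n))} (hs : braidFace x ∩ sumZeroSphere n = sphericalHull s)
    (hz : z ∈ braidFace x) (hz0 : z ∈ sumZeroHyperplane n) :
    ∃ c : EuclideanSpace ℝ (Fin n) → ℝ, (∀ v ∈ s, 0 ≤ c v) ∧ z = ∑ v ∈ s, c v • v := by
  by_cases h : z = 0
  · exact ⟨fun _ => 0, fun _ _ => le_rfl, by simp [h]⟩
  · have hn : ‖z‖ ≠ 0 := norm_ne_zero_iff.2 h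
    have hmem : ‖z‖⁻¹ • z ∈ sphericalHull s := by
      rw [← hs]
      refine ⟨smul_mem_braidFace (by positivity) hz, (sumZeroHyperplane n).smul_mem _ hz0, ?_⟩
      rw [norm_smul, norm_inv, norm_norm, inv_mul_cancel₀ hn]
    obtain ⟨_, c, hc, he⟩ := hmem
    refine ⟨fun v => ‖z‖ * c v, fun v hv => mul_nonneg (norm_nonneg _) (hc v hv), ?_⟩
    simp only [mul_smul]
    rw [← Finset.smul_sum, ← he, smul_smul, mul_inv_cancel₀ hn, one_smul]

/-- A face of a simplicial cell of the braid subdivision is again a cell. -/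
theorem sphericalHull_mem_braidCells {n : ℕ} {s t : Finset (EuclideanSpace ℝ (Fin n))}
    (hS : ∀ v ∈ s, v ∈ sumZeroSphere n)
    (hli : LinearIndepOn ℝ id (s : Set (EuclideanSpace ℝ (Fin n))))
    (hcell : sphericalHull s ∈ braidCells n) (hts : t ⊆ s) (ht : t.Nonempty) :
    sphericalHull t ∈ braidCells n := by
  classical
  obtain ⟨x, hx, hs⟩ := hcell
  have hs' := hs.symm
  have hvx : ∀ v ∈ s, v ∈ braidFace x := by
    intro v hv
    have : v ∈ sphericalHull s := ⟨hS v hv, fun w => if w = v then 1 else 0,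
      fun w _ => by dsimp only; split_ifs <;> norm_num, by simp [hv]⟩
    rw [hs] at this
    exact this.1
  have hli' := linearIndepOn_finset_iff.1 hli
  obtain ⟨x₀, hx₀⟩ : ∃ x₀, x₀ = ∑ v ∈ t, v := ⟨_, rfl⟩
  have hx₀s : x₀ = ∑ v ∈ s, (if v ∈ t then (1 : ℝ) else 0) • v := by
    rw [hx₀]
    simp only [ite_smul, one_smul, zero_smul]
    rw [← Finset.sum_filter, Finset.filter_mem_eq_inter, Finset.inter_eq_right.2 hts]
  have hne : x₀ ≠ 0 := by
    intro h0
    obtain ⟨v, hv⟩ := ht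
    have := hli' (fun v => if v ∈ t then (1 : ℝ) else 0) (by simpa [h0] using hx₀s.symm) v (hts hv)
    simp [hv] at this
  have hn : 0 < ‖x₀‖ := norm_pos_iff.2 hne
  have hx₀z : x₀ ∈ sumZeroHyperplane n := by
    rw [hx₀]; exact Submodule.sum_mem _ fun v hv => (hS v (hts hv)).1
  have hx₀x : x₀ ∈ braidFace x := by
    rw [hx₀s]
    exact sum_mem_braidFace (fun v _ => by split_ifs <;> norm_num) hvx
  have hface : braidFace (‖x₀‖⁻¹ • x₀) = braidFace x₀ := by
    have hi : 0 < ‖x₀‖⁻¹ := inv_pos.2 hn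
    ext y
    simp only [braidFace, Set.mem_ofPred_eq, PiLp.smul_apply, smul_eq_mul,
      mul_right_inj' hi.ne', mul_lt_mul_iff_right₀ hi]
  have hvx₀ : ∀ v ∈ t, v ∈ braidFace x₀ := by
    intro v hv i j
    have hcoord : ∀ k, x₀ k = ∑ w ∈ t, w k := by
      intro k; rw [hx₀]; simp
    have key : ∀ i j, x i ≤ x j → v i ≤ v j ∧ (x₀ j ≤ x₀ i → v j ≤ v i) := by
      intro i j hij
      have hle : ∀ w ∈ t, w i ≤ w j := by
        intro w hw
        rcases hij.lt_or_eq with h | h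
        · exact (hvx w (hts hw) i j).2 h
        · exact ((hvx w (hts hw) i j).1 h).le
      refine ⟨hle v hv, fun h => ?_⟩
      by_contra hlt
      have : ∑ w ∈ t, w i < ∑ w ∈ t, w j :=
        Finset.sum_lt_sum hle ⟨v, hv, not_le.1 hlt⟩
      rw [← hcoord, ← hcoord] at this
      exact absurd h (not_le.2 this)
    have key' : ∀ i j, x₀ i ≤ x₀ j → v i ≤ v j := by
      intro i j hij
      rcases le_total (x i) (x j) with h | h
      · exact (key i j h).1
      · exact (key j i h).2 hij
    exact ⟨fun h => le_antisymm (key' i j h.le) (key' j i h.ge), fun h => key' i j h.le⟩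
  refine ⟨‖x₀‖⁻¹ • x₀, ⟨(sumZeroHyperplane n).smul_mem _ hx₀z, ?_⟩, ?_⟩
  · rw [norm_smul, norm_inv, norm_norm, inv_mul_cancel₀ hn.ne']
  rw [hface]
  ext y
  constructor
  · rintro ⟨hy, c, hc, rfl⟩
    exact ⟨sum_mem_braidFace hc hvx₀, hy⟩
  · rintro ⟨hyf, hy⟩
    refine ⟨hy, ?_⟩
    obtain ⟨ε, hε, hz⟩ : ∃ ε : ℝ, 0 < ε ∧ ∀ i j, x₀ i < x₀ j → x₀ i - ε * y i < x₀ j - ε * y j := by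
      have : ∀ᶠ ε in nhdsWithin (0 : ℝ) (Set.Ioi 0), ∀ i j, x₀ i < x₀ j →
          x₀ i - ε * y i < x₀ j - ε * y j := by
        apply nhdsWithin_le_nhds
        refine Filter.eventually_all.2 fun i => Filter.eventually_all.2 fun j => ?_
        by_cases h : x₀ i < x₀ j
        · have h1 : ContinuousAt (fun ε : ℝ => x₀ i - ε * y i) 0 := by fun_prop
          have h2 : ContinuousAt (fun ε : ℝ => x₀ j - ε * y j) 0 := by fun_prop
          filter_upwards [h1.eventually_lt h2 (by simpa using h)] with ε hε _ using hε
        · exact Filter.Eventually.of_forall fun ε h' => absurd h' h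
      obtain ⟨ε, h1, h2⟩ := (this.and self_mem_nhdsWithin).exists
      exact ⟨ε, h2, h1⟩
    have hzf : x₀ - ε • y ∈ braidFace x₀ := by
      intro i j
      simp only [PiLp.sub_apply, PiLp.smul_apply, smul_eq_mul]
      exact ⟨fun h => by rw [h, (hyf i j).1 h], fun h => (hz i j h).le⟩
    obtain ⟨d, hd, hde⟩ := exists_coeff hs' (braidFace_subset hx₀x hzf)
      (Submodule.sub_mem _ hx₀z (Submodule.smul_mem _ _ hy.1))
    obtain ⟨c, hc, hce⟩ := exists_coeff hs' (braidFace_subset hx₀x hyf) hy.1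
    have hzero : ∑ v ∈ s, ((if v ∈ t then (1 : ℝ) else 0) - ε * c v - d v) • id v = 0 := by
      simp only [sub_smul, mul_smul, id, Finset.sum_sub_distrib, ← Finset.smul_sum]
      rw [← hx₀s, ← hce, ← hde, sub_self]
    have hcoef := hli' _ hzero
    refine ⟨c, fun v hv => hc v (hts hv), ?_⟩
    rw [hce]
    refine (Finset.sum_subset hts fun v hv hvt => ?_).symm
    have h1 := hcoef v hv
    rw [if_neg hvt] at h1
    have h2 := hc v hv
    have h3 := hd v hv
    have h4 : 0 ≤ ε * c v := mul_nonneg hε.le h2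
    have h5 : ε * c v = 0 := by linarith
    rw [(mul_eq_zero.1 h5).resolve_left hε.ne', zero_smul]

/-- The cells of the braid subdivision of the sphere that are contained in the set `A`. -/
def restrictedBraidCells {n : ℕ} (A : Set (EuclideanSpace ℝ (Fin n))) :
    Set (Set (EuclideanSpace ℝ (Fin n))) :=
  {C | C ∈ braidCells n ∧ C ⊆ A}

/-- The restriction of the braid subdivision of the sphere to the set `A`, as a simplicial complex:
its faces are the vertex sets of the spherical simplices among the cells contained in `A`. (That
every such cell is a spherical simplex has to be stated separately.) -/
def restrictedBraidComplex {n : ℕ} (A : Set (EuclideanSpace ℝ (Fin n))) :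
    PreAbstractSimplicialComplex (EuclideanSpace ℝ (Fin n)) where
  faces := {s | ∃ C ∈ restrictedBraidCells A, IsSphericalSimplex s C}
  isRelLowerSet_faces := by
    classical
    rintro s ⟨C, ⟨hC, hCA⟩, hs, hS, hli, rfl⟩
    refine ⟨hs, fun t hts ht => ⟨_, ⟨?_, ?_⟩, ht, fun v hv => hS v (hts hv),
      hli.mono (Finset.coe_subset.2 hts), rfl⟩⟩
    · exact sphericalHull_mem_braidCells hS hli hC hts ht
    · refine Set.Subset.trans ?_ hCA
      rintro y ⟨hy, c, hc, rfl⟩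
      refine ⟨hy, fun v => if v ∈ t then c v else 0, fun v _ => ?_, ?_⟩
      · dsimp only
        split_ifs with h
        · exact hc v h
        · exact le_rfl
      · simp only [ite_smul, zero_smul]
        rw [← Finset.sum_filter, Finset.filter_mem_eq_inter, Finset.inter_eq_right.2 hts]

/-!
For a vector `x`, consider the two-block partitions `A|Aᶜ` such that `x` is smaller on `A` than on
`Aᶜ`, the *initials* of `x`. Their first blocks are nested, and they record exactly which weak
inequalities hold between the coordinates of `x`: the ordered set partition into level sets, the
closed face of the braid arrangement that contains `x` in its relative interior, and the subspaces
of the arrangement through `x` can all be read off from them.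

To `A|Aᶜ` belongs a ray of the braid arrangement, spanned by the sum-zero vector with one value on
`A` and a larger one on `Aᶜ`. A nonnegative combination of rays with nested first blocks has as its
initials precisely the rays with positive coefficient. Hence the coefficients are unique, and they
always exist: subtracting the right multiple of one initial of `x` removes it from the initials of
`x` without creating new ones. So the closed faces are simplicial cones, and placing the vertices of
the complex at the rays and projecting radially gives a homeomorphism with the sphere that
preserves initials, and therefore carries `Δ_H` to the arrangement for every `H` at once.
-/

open OrderedSetPartition

/-! ### Isomorphisms and geometric realizations -/

section SimplicialComplex

variable {α β : Type*}

theorem SimpliciallyIsomorphic.of_embedding {K : PreAbstractSimplicialComplex α}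
    {L : PreAbstractSimplicialComplex β} (g : α ↪ β)
    (hface : ∀ s : Finset α, s ∈ K.faces ↔ s.map g ∈ L.faces)
    (hvertex : ∀ b, {b} ∈ L.faces → ∃ a, g a = b) : SimpliciallyIsomorphic K L := by
  have hv : ∀ a, {a} ∈ K.faces ↔ {g a} ∈ L.faces := fun a => by
    rw [hface, Finset.map_singleton]
  refine ⟨Equiv.ofBijective (fun a : K.Vertex => (⟨g a.1, (hv a.1).1 a.2⟩ : L.Vertex))
    ⟨fun a b hab => Subtype.ext (g.injective (Subtype.ext_iff.1 hab)), ?_⟩, fun s => ?_⟩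
  · rintro ⟨b, hb⟩
    obtain ⟨a, rfl⟩ := hvertex b hb
    exact ⟨⟨a, (hv a).2 hb⟩, rfl⟩
  · rw [hface, Finset.map_map, Finset.map_map]
    rfl

theorem isCompact_geometricRealization {K : PreAbstractSimplicialComplex α}
    (hK : K.faces.Finite) : IsCompact (geometricRealization K) := by
  have hunion : geometricRealization K = ⋃ s ∈ K.faces,
      {w | (∀ v, 0 ≤ w v) ∧ (∀ v ∉ s, w v = 0) ∧ ∑ v ∈ s, w v = 1} := by
    ext w
    simp only [geometricRealization, Set.mem_iUnion, Set.mem_ofPred_eq, exists_prop]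
  rw [hunion]
  refine hK.isCompact_biUnion fun s _ =>
    (isCompact_Icc (a := (0 : α → ℝ)) (b := 1)).of_isClosed_subset ?_ ?_
  · have hzero : IsClosed {w : α → ℝ | ∀ v ∉ s, w v = 0} :=
      isClosed_set_pi (i := {v | v ∉ s}) (s := fun _ => {0}) fun _ _ => isClosed_singleton
    exact isClosed_Ici.inter (hzero.inter (isClosed_eq (by fun_prop) continuous_const))
  · rintro w ⟨hw, hzero, hsum⟩
    refine ⟨hw, fun v => ?_⟩
    by_cases hv : v ∈ s
    · exact (Finset.single_le_sum (fun v _ => hw v) hv).trans_eq hsum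
    · exact (hzero v hv).trans_le zero_le_one

variable [Fintype α]

/-- The support of a coefficient vector. If it is the vector of barycentric coordinates of a point
of a geometric realization, this is the vertex set of the face whose relative interior contains the
point. -/
noncomputable def carrierFace (w : α → ℝ) : Finset α :=
  Finset.univ.filter fun v => w v ≠ 0

theorem mem_carrierFace {w : α → ℝ} {v : α} : v ∈ carrierFace w ↔ w v ≠ 0 := by
  simp [carrierFace]

theorem sum_carrierFace (w : α → ℝ) : ∑ v ∈ carrierFace w, w v = ∑ v, w v :=
  Finset.sum_filter_ne_zero _

theorem carrierFace_smul {a : ℝ} (ha : a ≠ 0) (w : α → ℝ) :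
    carrierFace (a • w) = carrierFace w := by
  ext v
  simp [mem_carrierFace, ha]

theorem mem_geometricRealization {K : PreAbstractSimplicialComplex α} {w : α → ℝ} :
    w ∈ geometricRealization K ↔ 0 ≤ w ∧ ∑ v, w v = 1 ∧ carrierFace w ∈ K.faces := by
  constructor
  · rintro ⟨s, hs, hw, hzero, hsum⟩
    have hsub : carrierFace w ⊆ s := fun v hv =>
      by_contra fun h => mem_carrierFace.1 hv (hzero v h)
    have hsum' : ∑ v, w v = 1 :=
      (Finset.sum_subset (Finset.subset_univ s) fun v _ hv => hzero v hv).symm.trans hsum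
    refine ⟨hw, hsum', (K.isRelLowerSet_faces hs).2 hsub ?_⟩
    refine Finset.nonempty_of_sum_ne_zero (f := w) ?_
    rw [sum_carrierFace, hsum']
    exact one_ne_zero
  · rintro ⟨hw, hsum, hK⟩
    exact ⟨_, hK, hw, fun v hv => not_not.1 fun h => hv (mem_carrierFace.2 h),
      (sum_carrierFace w).trans hsum⟩

end SimplicialComplex

/-! ### The arrangement of a hypergraph -/

section Arrangement

variable {n : ℕ} {H : Hypergraph (Fin n)}

theorem squarefreeMonomial_eq_monomial (A : Finset (Fin n)) :
    squarefreeMonomial A = MvPolynomial.monomial (Multiset.toFinsupp A.val) 1 := by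
  rw [← Finset.sum_multiset_singleton A, map_sum, MvPolynomial.monomial_sum_one]
  simp [squarefreeMonomial, MvPolynomial.X]

theorem squarefreeMonomial_mem_edgeIdeal {A : Finset (Fin n)} :
    squarefreeMonomial A ∈ edgeIdeal H ↔
      ∃ F : Finset (Fin n), (F : Set (Fin n)) ∈ H.edgeSet ∧ F ⊆ A := by
  have hspan : edgeIdeal H = Ideal.span ((fun s => MvPolynomial.monomial s (1 : ℝ)) ''
      ((fun F : Finset (Fin n) => Multiset.toFinsupp F.val) ''
        {F | (F : Set (Fin n)) ∈ H.edgeSet})) := by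
    rw [edgeIdeal]
    congr 1
    ext m
    simp [squarefreeMonomial_eq_monomial, eq_comm]
  rw [hspan, MvPolynomial.mem_ideal_span_monomial_image, squarefreeMonomial_eq_monomial,
    MvPolynomial.support_monomial, if_neg one_ne_zero]
  simp only [Finset.mem_singleton, forall_eq, Set.exists_mem_image, Set.mem_ofPred_eq,
    ← Finsupp.coe_orderIsoMultiset_symm, OrderIso.le_iff_le, Finset.val_le_iff]

theorem mem_hypergraphArrangement {x : EuclideanSpace ℝ (Fin n)} :
    x ∈ hypergraphArrangement H ↔
      x ∈ sumZeroHyperplane n ∧ ∃ e ∈ H.edgeSet, ∀ i ∈ e, ∀ j ∈ e, x i = x j := by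
  classical
  simp only [hypergraphArrangement, canonicalArrangement, Set.mem_iUnion, exists_prop]
  constructor
  · rintro ⟨_, ⟨A, hA, rfl⟩, hxA, hx⟩
    obtain ⟨F, hF, hFA⟩ := squarefreeMonomial_mem_edgeIdeal.1 hA.1
    exact ⟨hx, F, hF, fun i hi j hj => hxA i (hFA hi) j (hFA hj)⟩
  · rintro ⟨hx, e, he, hxe⟩
    have hmem : squarefreeMonomial e.toFinset ∈ edgeIdeal H :=
      squarefreeMonomial_mem_edgeIdeal.2 ⟨e.toFinset, by simpa using he, subset_rfl⟩
    obtain ⟨A, hAe, hA⟩ := exists_minimal_le_of_wellFoundedLT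
      (fun A : Finset (Fin n) => squarefreeMonomial A ∈ edgeIdeal H) _ hmem
    refine ⟨_, ⟨A, ⟨hA.1, fun B hB hB' => hB.2 (hA.2 hB' hB.1)⟩, rfl⟩, fun i hi j hj => ?_, hx⟩
    exact hxe i (Set.mem_toFinset.1 (hAe hi)) j (Set.mem_toFinset.1 (hAe hj))

end Arrangement

/-! ### Vertices of spherical simplices -/

section SphericalSimplex

variable {n : ℕ} {s t : Finset (EuclideanSpace ℝ (Fin n))}

theorem mem_sphericalHull_self {v : EuclideanSpace ℝ (Fin n)} (hv : v ∈ s)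
    (hsphere : v ∈ sumZeroSphere n) : v ∈ sphericalHull s := by
  classical
  have hnonneg : (0 : EuclideanSpace ℝ (Fin n) → ℝ) ≤ Pi.single v 1 :=
    Pi.single_nonneg.2 zero_le_one
  exact ⟨hsphere, Pi.single v 1, fun w _ => hnonneg w, by simp [Pi.single_apply, hv]⟩

theorem vertices_subset_of_sphericalHull_eq (hs : ∀ v ∈ s, v ∈ sumZeroSphere n)
    (hli : LinearIndepOn ℝ id (s : Set (EuclideanSpace ℝ (Fin n))))
    (ht : ∀ u ∈ t, u ∈ sumZeroSphere n) (hst : sphericalHull s = sphericalHull t) : s ⊆ t := by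
  classical
  intro v hv
  obtain ⟨-, c, hc, hvc⟩ : v ∈ sphericalHull t := hst ▸ mem_sphericalHull_self hv (hs v hv)
  have hmem : ∀ u ∈ t, ∃ d : EuclideanSpace ℝ (Fin n) → ℝ,
      (∀ w ∈ s, 0 ≤ d w) ∧ u = ∑ w ∈ s, d w • w := fun u hu =>
    (hst ▸ mem_sphericalHull_self hu (ht u hu) : u ∈ sphericalHull s).2
  choose! d hd hud using hmem
  have hexpand : ∑ w ∈ s, (∑ u ∈ t, c u * d u w - if w = v then 1 else 0) • id w = 0 := by
    simp only [id, sub_smul, Finset.sum_sub_distrib, ite_smul, one_smul, zero_smul,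
      Finset.sum_ite_eq', hv, if_true, Finset.sum_smul, mul_smul]
    rw [Finset.sum_comm, sub_eq_zero]
    simp only [← Finset.smul_sum]
    rw [hvc]
    exact Finset.sum_congr rfl fun u hu => by rw [← hud u hu]
  have hcoeff : ∀ w ∈ s, ∑ u ∈ t, c u * d u w = if w = v then 1 else 0 := fun w hw =>
    sub_eq_zero.1 (linearIndepOn_finset_iff.1 hli _ hexpand w hw)
  obtain ⟨u, hu, hcu⟩ : ∃ u ∈ t, c u * d u v ≠ 0 :=
    Finset.exists_ne_zero_of_sum_ne_zero (by simp [hcoeff v hv])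
  have hzero : ∀ w ∈ s, w ≠ v → d u w = 0 := fun w hw hwv => by
    have hsum := (hcoeff w hw).trans (if_neg hwv)
    exact (mul_eq_zero.1 ((Finset.sum_eq_zero_iff_of_nonneg fun u hu =>
      mul_nonneg (hc u hu) (hd u hu w hw)).1 hsum u hu)).resolve_left (left_ne_zero_of_mul hcu)
  have huv : u = d u v • v :=
    (hud u hu).trans (Finset.sum_eq_single_of_mem v hv fun w hw hwv => by simp [hzero w hw hwv])
  have hone : d u v = 1 := by
    have := congrArg norm huv
    rwa [norm_smul, (ht u hu).2, (hs v hv).2, Real.norm_of_nonneg (hd u hu v hv), mul_one,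
      eq_comm] at this
  rw [hone, one_smul] at huv
  exact huv ▸ hu

theorem IsSphericalSimplex.vertices_unique {C : Set (EuclideanSpace ℝ (Fin n))}
    (hs : IsSphericalSimplex s C) (ht : IsSphericalSimplex t C) : s = t := by
  obtain ⟨-, hs, hlis, hCs⟩ := hs
  obtain ⟨-, ht, hlit, hCt⟩ := ht
  exact (vertices_subset_of_sphericalHull_eq hs hlis ht (hCs.symm.trans hCt)).antisymm
    (vertices_subset_of_sphericalHull_eq ht hlit hs (hCt.symm.trans hCs))

end SphericalSimplex

/-! ### Two-block partitions below a partition or a vector -/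

namespace OrderedSetPartition

variable {n : ℕ}

/-- The first block `A` of a two-block partition `A|Aᶜ`, which determines it. -/
def firstBlock (v : TwoBlock n) : Finset (Fin n) := v.1.blocks.headI

theorem blocks_eq (v : TwoBlock n) : v.1.blocks = [firstBlock v, (firstBlock v)ᶜ] := by
  obtain ⟨v, hv⟩ := v
  obtain ⟨a, b, hab⟩ := List.length_eq_two.1 hv
  have hdisj := v.disjoint
  have hcover := v.cover
  simp only [hab, List.pairwise_cons, List.mem_cons, List.not_mem_nil, or_false, forall_eq,
    exists_eq_or_imp, exists_eq_left] at hdisj hcover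
  have hb : b = aᶜ :=
    (IsCompl.of_eq hdisj.1.eq_bot (Finset.eq_univ_iff_forall.2 fun i =>
      Finset.mem_union.2 (hcover i))).compl_eq.symm
  simp [firstBlock, hab, hb]

theorem firstBlock_nonempty (v : TwoBlock n) : (firstBlock v).Nonempty :=
  v.1.nonempty_of_mem _ (by simp [blocks_eq])

theorem compl_firstBlock_nonempty (v : TwoBlock n) : ((firstBlock v)ᶜ).Nonempty :=
  v.1.nonempty_of_mem _ (by simp [blocks_eq])

theorem firstBlock_injective : Function.Injective (firstBlock (n := n)) := fun v w h =>
  Subtype.ext (OrderedSetPartition.ext (by rw [blocks_eq, blocks_eq, h]))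

theorem exists_firstBlock_eq {A : Finset (Fin n)} (h : A.Nonempty) (h' : Aᶜ.Nonempty) :
    ∃ v : TwoBlock n, firstBlock v = A :=
  ⟨⟨⟨[A, Aᶜ], by simp [h, h'], by simp [disjoint_compl_right], fun i => by simp [em]⟩, rfl⟩, rfl⟩

noncomputable instance : Fintype (TwoBlock n) :=
  Fintype.ofInjective firstBlock firstBlock_injective

instance : DecidableEq (TwoBlock n) :=
  firstBlock_injective.decidableEq

section BlockIndex

variable (B : OrderedSetPartition n)

theorem exists_mem_block (i : Fin n) : ∃ k : Fin B.blocks.length, i ∈ B.blocks[k] := by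
  obtain ⟨b, hb, hi⟩ := B.cover i
  obtain ⟨k, hk, rfl⟩ := List.getElem_of_mem hb
  exact ⟨⟨k, hk⟩, hi⟩

/-- The position of the block that contains `i`. This turns an ordered set partition into a vector
whose level sets, in increasing order, are the blocks. -/
noncomputable def blockIndex (i : Fin n) : Fin B.blocks.length := (B.exists_mem_block i).choose

variable {B}

theorem mem_block_iff {i : Fin n} {k : ℕ} (hk : k < B.blocks.length) :
    i ∈ B.blocks[k] ↔ (B.blockIndex i : ℕ) = k := by
  have hmem : i ∈ B.blocks[(B.blockIndex i : ℕ)] := (B.exists_mem_block i).choose_spec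
  refine ⟨fun hi => ?_, fun h => by simpa only [h] using hmem⟩
  by_contra hne
  have hdisj := List.pairwise_iff_getElem.1 B.disjoint
  rcases Nat.lt_or_gt_of_ne hne with hlt | hlt
  · exact Finset.disjoint_left.1 (hdisj _ _ _ hk hlt) hmem hi
  · exact Finset.disjoint_left.1 (hdisj _ _ hk _ hlt) hi hmem

theorem exists_block_superset_iff [Nonempty (Fin n)] {e : Set (Fin n)} :
    (∃ b ∈ B.blocks, e ⊆ b) ↔ ∀ i ∈ e, ∀ j ∈ e, B.blockIndex i = B.blockIndex j := by
  constructor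
  · rintro ⟨b, hb, heb⟩ i hi j hj
    obtain ⟨k, hk, rfl⟩ := List.getElem_of_mem hb
    exact Fin.ext (((mem_block_iff hk).1 (heb hi)).trans ((mem_block_iff hk).1 (heb hj)).symm)
  · intro hconst
    obtain ⟨i, hi⟩ : ∃ i, e.Nonempty → i ∈ e := by
      rcases e.eq_empty_or_nonempty with rfl | ⟨i, hi⟩
      · exact ⟨Classical.arbitrary _, fun h => h.some_mem⟩
      · exact ⟨i, fun _ => hi⟩
    refine ⟨_, List.getElem_mem (B.blockIndex i).2, fun j hj => ?_⟩
    exact (mem_block_iff _).2 (congrArg Fin.val (hconst j hj i (hi ⟨j, hj⟩)))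

theorem mem_union_take_iff {i : Fin n} {k : ℕ} :
    i ∈ union (B.blocks.take k) ↔ (B.blockIndex i : ℕ) < k := by
  rw [mem_union]
  constructor
  · rintro ⟨b, hb, hi⟩
    obtain ⟨m, hm, rfl⟩ := List.mem_take_iff_getElem.1 hb
    rw [(mem_block_iff _).1 hi]
    exact hm.trans_le (min_le_left _ _)
  · exact fun hi => ⟨_, List.mem_take_iff_getElem.2 ⟨_, lt_min hi (B.blockIndex i).2, rfl⟩,
      (mem_block_iff _).2 rfl⟩

theorem mem_union_drop_iff {i : Fin n} {k : ℕ} :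
    i ∈ union (B.blocks.drop k) ↔ k ≤ (B.blockIndex i : ℕ) := by
  rw [mem_union]
  constructor
  · rintro ⟨b, hb, hi⟩
    obtain ⟨m, hm, rfl⟩ := List.mem_drop_iff_getElem.1 hb
    rw [(mem_block_iff _).1 hi]
    exact Nat.le_add_right k m
  · intro hi
    obtain ⟨m, hm⟩ := Nat.exists_eq_add_of_le hi
    have hlt : m + k < B.blocks.length := by
      rw [Nat.add_comm, ← hm]
      exact (B.blockIndex i).2
    exact ⟨_, List.mem_drop_iff_getElem.2 ⟨m, hlt, rfl⟩, (mem_block_iff _).2 hm⟩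

theorem le_iff_exists_firstBlock_eq_union_take {v : TwoBlock n} :
    v.1 ≤ B ↔ ∃ k, firstBlock v = union (B.blocks.take k) := by
  constructor
  · intro h
    obtain ⟨p, q, -, -, hB, hv⟩ := exists_split_of_le v.2 h
    refine ⟨p.length, ?_⟩
    rw [hB, List.take_left, firstBlock, hv, List.headI_cons]
  · rintro ⟨k, hk⟩
    have hdrop : (firstBlock v)ᶜ = union (B.blocks.drop k) := by
      ext i
      rw [Finset.mem_compl, hk, mem_union_take_iff, mem_union_drop_iff, not_lt]
    refine le_of_split _ B (B.blocks.take k) (B.blocks.drop k) rfl ?_ ?_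
      (List.take_append_drop k _).symm (by rw [blocks_eq, hdrop, hk])
    · intro hnil
      exact (firstBlock_nonempty v).ne_empty (by rw [hk, hnil]; rfl)
    · intro hnil
      exact (compl_firstBlock_nonempty v).ne_empty (by rw [hdrop, hnil]; rfl)

end BlockIndex

section Initials

variable {α : Type*} [LinearOrder α] {x : Fin n → α}

/-- The two-block partitions `A|Aᶜ` such that `x` is smaller on `A` than on the complement of `A`.
They are the vertices below the ordered set partition into the level sets of `x`. -/
noncomputable def initials (x : Fin n → α) : Finset (TwoBlock n) :=
  Finset.univ.filter fun v => ∀ i ∈ firstBlock v, ∀ j ∉ firstBlock v, x i < x j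

theorem mem_initials {v : TwoBlock n} :
    v ∈ initials x ↔ ∀ i ∈ firstBlock v, ∀ j ∉ firstBlock v, x i < x j := by
  simp [initials]

theorem le_iff_mem_initials_blockIndex {v : TwoBlock n} {B : OrderedSetPartition n} :
    v.1 ≤ B ↔ v ∈ initials B.blockIndex := by
  rw [le_iff_exists_firstBlock_eq_union_take, mem_initials]
  constructor
  · rintro ⟨k, hk⟩ i hi j hj
    rw [hk, mem_union_take_iff] at hi hj
    exact hi.trans_le (not_lt.1 hj)
  · intro hv
    obtain ⟨a, ha, hmax⟩ := (firstBlock v).exists_max_image B.blockIndex (firstBlock_nonempty v)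
    refine ⟨B.blockIndex a + 1, Finset.ext fun i => ?_⟩
    rw [mem_union_take_iff, Nat.lt_succ_iff]
    exact ⟨hmax i, fun hle => by_contra fun hi => (hv a ha i hi).not_ge hle⟩

theorem exists_mem_initials_of_lt {i j : Fin n} (hij : x i < x j) :
    ∃ v ∈ initials x, i ∈ firstBlock v ∧ j ∉ firstBlock v := by
  obtain ⟨v, hv⟩ := exists_firstBlock_eq (A := Finset.univ.filter fun k => x k ≤ x i)
    ⟨i, by simp⟩ ⟨j, by simpa using hij⟩
  have hmem : ∀ k, k ∈ firstBlock v ↔ x k ≤ x i := by simp [hv]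
  exact ⟨v, mem_initials.2 fun a ha b hb =>
    ((hmem a).1 ha).trans_lt (not_le.1 (mt (hmem b).2 hb)), (hmem i).2 le_rfl,
    mt (hmem j).1 hij.not_ge⟩

theorem exists_isMax_firstBlock_isMin_compl (v : TwoBlock n) (x : Fin n → α) :
    ∃ i ∈ firstBlock v, ∃ j ∉ firstBlock v,
      (∀ k ∈ firstBlock v, x k ≤ x i) ∧ ∀ k ∉ firstBlock v, x j ≤ x k := by
  obtain ⟨i, hi, hmax⟩ := (firstBlock v).exists_max_image x (firstBlock_nonempty v)
  obtain ⟨j, hj, hmin⟩ := (firstBlock v)ᶜ.exists_min_image x (compl_firstBlock_nonempty v)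
  simp only [Finset.mem_compl] at hj hmin
  exact ⟨i, hi, j, hj, hmax, hmin⟩

theorem initials_eq_of_lt_iff {s : Finset (TwoBlock n)}
    (h : ∀ i j, x i < x j ↔ ∃ v ∈ s, i ∈ firstBlock v ∧ j ∉ firstBlock v) : initials x = s := by
  ext v
  refine ⟨fun hv => ?_, fun hv => mem_initials.2 fun i hi j hj => (h i j).2 ⟨v, hv, hi, hj⟩⟩
  obtain ⟨i, hi, j, hj, hmax, hmin⟩ := exists_isMax_firstBlock_isMin_compl v x
  obtain ⟨u, hu, hiu, hju⟩ := (h i j).1 (mem_initials.1 hv i hi j hj)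
  have huv : u = v := firstBlock_injective <| Finset.ext fun k =>
    ⟨fun hk => by_contra fun hkv => (hmin k hkv).not_gt ((h k j).2 ⟨u, hu, hk, hju⟩),
      fun hk => by_contra fun hku => (hmax k hk).not_gt ((h i k).2 ⟨u, hu, hiu, hku⟩)⟩
  exact huv ▸ hu

/-- The ordered set partition into the level sets of `x`, in increasing order. -/
noncomputable def ofFun (x : Fin n → α) : OrderedSetPartition n where
  blocks := (Finset.univ.image x).sort.map fun a => Finset.univ.filter fun i => x i = a
  nonempty_of_mem := by
    intro b hb
    simp only [List.mem_map, Finset.mem_sort, Finset.mem_image, Finset.mem_univ, true_and] at hb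
    obtain ⟨_, ⟨i, rfl⟩, rfl⟩ := hb
    exact ⟨i, by simp⟩
  disjoint := by
    rw [List.pairwise_map]
    refine (Finset.sort_nodup _ _).imp fun {a b} hab => Finset.disjoint_left.2 fun i hi hi' => ?_
    simp only [Finset.mem_filter, Finset.mem_univ, true_and] at hi hi'
    exact hab (hi.symm.trans hi')
  cover := fun i => ⟨_, List.mem_map.2 ⟨x i, by simp, rfl⟩, by simp⟩

theorem blockIndex_ofFun_lt_iff {i j : Fin n} :
    (ofFun x).blockIndex i < (ofFun x).blockIndex j ↔ x i < x j := by
  have hlength : (ofFun x).blocks.length = (Finset.univ.image x).sort.length :=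
    List.length_map _
  have hvalue : ∀ k, x k = (Finset.univ.image x).sort[(ofFun x).blockIndex k] := fun k => by
    have hk := (mem_block_iff ((ofFun x).blockIndex k).2).2 (Eq.refl ((ofFun x).blockIndex k : ℕ))
    simpa [ofFun] using hk
  rw [hvalue i, hvalue j]
  exact ((Finset.sortedLT_sort _).getElem_lt_getElem_iff (hi := hlength ▸ Fin.is_lt _)
    (hj := hlength ▸ Fin.is_lt _)).symm

theorem initials_blockIndex_ofFun : initials (ofFun x).blockIndex = initials x := by
  simp only [initials, blockIndex_ofFun_lt_iff]

/-- The coordinates in `e` are not all on the same side of the two-block partition `v`. -/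
def Separates (v : TwoBlock n) (e : Set (Fin n)) : Prop :=
  ∃ i ∈ e, ∃ j ∈ e, i ∈ firstBlock v ∧ j ∉ firstBlock v

theorem forall_eq_iff_forall_not_separates {e : Set (Fin n)} :
    (∀ i ∈ e, ∀ j ∈ e, x i = x j) ↔ ∀ v ∈ initials x, ¬Separates v e := by
  constructor
  · rintro hconst v hv ⟨i, hi, j, hj, hiv, hjv⟩
    exact (mem_initials.1 hv i hiv j hjv).ne (hconst i hi j hj)
  · intro h
    have hle : ∀ i ∈ e, ∀ j ∈ e, x j ≤ x i := fun i hi j hj => not_lt.1 fun hij => by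
      obtain ⟨v, hv, hiv, hjv⟩ := exists_mem_initials_of_lt hij
      exact h v hv ⟨i, hi, j, hj, hiv, hjv⟩
    exact fun i hi j hj => le_antisymm (hle j hj i hi) (hle i hi j hj)

/-- A set of two-block partitions whose first blocks are nested, like the set of those below a given
ordered set partition. -/
def IsFlag (s : Finset (TwoBlock n)) : Prop :=
  IsChain (· ⊆ ·) (firstBlock '' (s : Set (TwoBlock n)))

theorem IsFlag.mono {s t : Finset (TwoBlock n)} (ht : IsFlag t) (hst : s ⊆ t) : IsFlag s :=
  IsChain.mono (Set.image_mono (Finset.coe_subset.2 hst)) ht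

theorem isFlag_initials (x : Fin n → α) : IsFlag (initials x) := by
  rintro _ ⟨v, hv, rfl⟩ _ ⟨w, hw, rfl⟩ -
  by_contra! h
  obtain ⟨⟨i, hiv, hiw⟩, j, hjw, hjv⟩ := h.imp Finset.not_subset.1 Finset.not_subset.1
  exact (mem_initials.1 hv i hiv j hjv).asymm (mem_initials.1 hw j hjw i hiw)

end Initials

end OrderedSetPartition

/-! ### Rays of the braid arrangement -/

open NormedSpace (normalize norm_normalize normalize_smul_of_pos normalize_eq_self_of_norm_eq_one)

section Rays

variable {n : ℕ}

section Vector

variable {x y : EuclideanSpace ℝ (Fin n)}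

theorem normalize_mem_sumZeroSphere (hx : x ∈ sumZeroHyperplane n) (h0 : x ≠ 0) :
    normalize x ∈ sumZeroSphere n :=
  ⟨(sumZeroHyperplane n).smul_mem _ hx, norm_normalize h0⟩

theorem ne_zero_of_mem_sumZeroSphere (hx : x ∈ sumZeroSphere n) : x ≠ 0 :=
  norm_ne_zero_iff.1 (hx.2.trans_ne one_ne_zero)

theorem normalize_apply_lt_iff (i j : Fin n) : normalize x i < normalize x j ↔ x i < x j := by
  rcases eq_or_ne x 0 with rfl | h0
  · simp
  · exact mul_lt_mul_iff_right₀ (inv_pos.2 (norm_pos_iff.2 h0))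

theorem initials_normalize (x : EuclideanSpace ℝ (Fin n)) :
    initials (normalize x : EuclideanSpace ℝ (Fin n)) = initials x := by
  simp only [initials, normalize_apply_lt_iff]

theorem initials_nonempty (hx : x ∈ sumZeroHyperplane n) (h0 : x ≠ 0) :
    (initials x).Nonempty := by
  by_contra hempty
  rw [Finset.not_nonempty_iff_eq_empty] at hempty
  have hconst : ∀ i j, x j ≤ x i := fun i j => not_lt.1 fun hij => by
    obtain ⟨v, hv, -⟩ := exists_mem_initials_of_lt hij
    simp [hempty] at hv
  refine h0 (PiLp.ext fun i => ?_)
  have hsum : ∑ j, x j = n * x i := by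
    rw [Finset.sum_congr rfl fun j _ => (hconst i j).antisymm (hconst j i)]
    simp
  have hn : (n : ℝ) ≠ 0 := Nat.cast_ne_zero.2 i.pos.ne'
  exact (mul_eq_zero.1 (hsum.symm.trans hx)).resolve_left hn

theorem mem_braidFace_iff : y ∈ braidFace x ↔ initials y ⊆ initials x := by
  constructor
  · intro hy v hv
    rw [mem_initials] at hv ⊢
    intro i hi j hj
    by_contra! hji
    refine (hv i hi j hj).not_ge ?_
    rcases hji.lt_or_eq with hlt | heq
    · exact (hy j i).2 hlt
    · exact ((hy j i).1 heq).le
  · intro h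
    have hmono : ∀ i j, x i ≤ x j → y i ≤ y j := fun i j hij => not_lt.1 fun hlt => by
      obtain ⟨v, hv, hjv, hiv⟩ := exists_mem_initials_of_lt hlt
      exact (mem_initials.1 (h hv) j hjv i hiv).not_ge hij
    exact fun i j => ⟨fun hij => (hmono i j hij.le).antisymm (hmono j i hij.ge),
      fun hij => hmono i j hij.le⟩

end Vector

/-- The projection to the sum-zero hyperplane of the indicator vector of the complement of `A`. -/
noncomputable def cutVector (A : Finset (Fin n)) : EuclideanSpace ℝ (Fin n) :=
  WithLp.toLp 2 fun i => (A.card : ℝ) / n - if i ∈ A then 1 else 0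

theorem cutVector_mem_sumZeroHyperplane (A : Finset (Fin n)) :
    cutVector A ∈ sumZeroHyperplane n := by
  change ∑ i, ((A.card : ℝ) / n - if i ∈ A then 1 else 0) = 0
  rcases eq_or_ne n 0 with rfl | hn
  · simp
  · have hn' : (n : ℝ) ≠ 0 := Nat.cast_ne_zero.2 hn
    simp [mul_div_cancel₀ _ hn']

theorem cutVector_apply_lt_iff {A : Finset (Fin n)} (i j : Fin n) :
    cutVector A i < cutVector A j ↔ i ∈ A ∧ j ∉ A := by
  by_cases hi : i ∈ A <;> by_cases hj : j ∈ A <;> simp [cutVector, hi, hj]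

/-- The unit vector on the ray of the braid arrangement that belongs to the two-block partition
`A|Aᶜ`: it is constant on `A` and on `Aᶜ`, and smaller on `A`. -/
noncomputable def cutRay (v : TwoBlock n) : EuclideanSpace ℝ (Fin n) :=
  normalize (cutVector (firstBlock v))

variable {v : TwoBlock n}

theorem cutRay_apply_lt_iff {i j : Fin n} :
    cutRay v i < cutRay v j ↔ i ∈ firstBlock v ∧ j ∉ firstBlock v :=
  (normalize_apply_lt_iff i j).trans (cutVector_apply_lt_iff i j)

theorem cutRay_apply_congr {i j : Fin n} (h : i ∈ firstBlock v ↔ j ∈ firstBlock v) :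
    cutRay v i = cutRay v j :=
  le_antisymm
    (not_lt.1 fun hlt => (cutRay_apply_lt_iff.1 hlt).2 (h.2 (cutRay_apply_lt_iff.1 hlt).1))
    (not_lt.1 fun hlt => (cutRay_apply_lt_iff.1 hlt).2 (h.1 (cutRay_apply_lt_iff.1 hlt).1))

theorem initials_cutRay (v : TwoBlock n) : initials (cutRay v) = {v} :=
  initials_eq_of_lt_iff fun i j => by simp [cutRay_apply_lt_iff]

theorem cutRay_injective : Function.Injective (cutRay (n := n)) := fun v w h =>
  Finset.singleton_injective (by rw [← initials_cutRay, ← initials_cutRay, h])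

theorem cutRay_mem_sumZeroSphere (v : TwoBlock n) : cutRay v ∈ sumZeroSphere n := by
  refine normalize_mem_sumZeroSphere (cutVector_mem_sumZeroHyperplane _) fun h0 => ?_
  obtain ⟨i, hi⟩ := firstBlock_nonempty v
  obtain ⟨j, hj⟩ := compl_firstBlock_nonempty v
  simpa [h0] using (cutVector_apply_lt_iff i j).2 ⟨hi, Finset.mem_compl.1 hj⟩

/-- `cutRay` as an embedding, which carries sets of two-block partitions to sets of vectors. -/
noncomputable def cutRayEmbedding (n : ℕ) : TwoBlock n ↪ EuclideanSpace ℝ (Fin n) :=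
  ⟨cutRay, cutRay_injective⟩

/-! ### Nonnegative combinations of the rays of a flag -/

/-- The linear combination of the rays with given coefficients. -/
noncomputable def rayCombination : (TwoBlock n → ℝ) →ₗ[ℝ] EuclideanSpace ℝ (Fin n) :=
  Fintype.linearCombination ℝ cutRay

variable {w : TwoBlock n → ℝ}

theorem rayCombination_apply (w : TwoBlock n → ℝ) (i : Fin n) :
    rayCombination w i = ∑ v, w v * cutRay v i := by
  simp [rayCombination, Fintype.linearCombination_apply]

theorem rayCombination_single (v : TwoBlock n) (a : ℝ) :
    rayCombination (Pi.single v a) = a • cutRay v :=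
  Fintype.linearCombination_apply_single ℝ _ v a

theorem rayCombination_eq_sum {s : Finset (TwoBlock n)} (hs : carrierFace w ⊆ s) :
    rayCombination w = ∑ v ∈ s, w v • cutRay v :=
  (Finset.sum_subset (Finset.subset_univ s) fun v _ hv => by
    rw [not_not.1 fun h => hv (hs (mem_carrierFace.2 h)), zero_smul]).symm

theorem rayCombination_mem_sumZeroHyperplane (w : TwoBlock n → ℝ) :
    rayCombination w ∈ sumZeroHyperplane n :=
  Submodule.sum_mem _ fun v _ => Submodule.smul_mem _ _ (cutRay_mem_sumZeroSphere v).1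

theorem rayCombination_apply_lt_iff (hw : 0 ≤ w) (hflag : IsFlag (carrierFace w)) {i j : Fin n} :
    rayCombination w i < rayCombination w j ↔
      ∃ v ∈ carrierFace w, i ∈ firstBlock v ∧ j ∉ firstBlock v := by
  simp only [rayCombination_apply]
  constructor
  · intro hlt
    obtain ⟨v, -, hv⟩ := Finset.exists_lt_of_sum_lt hlt
    exact ⟨v, mem_carrierFace.2 fun h0 => by simp [h0] at hv,
      cutRay_apply_lt_iff.1 (lt_of_mul_lt_mul_left hv (hw v))⟩
  · rintro ⟨v, hv, hiv, hjv⟩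
    refine Finset.sum_lt_sum (fun u _ => ?_) ⟨v, Finset.mem_univ v, mul_lt_mul_of_pos_left
      (cutRay_apply_lt_iff.2 ⟨hiv, hjv⟩) ((hw v).lt_of_ne' (mem_carrierFace.1 hv))⟩
    rcases eq_or_ne (w u) 0 with hu | hu
    · simp [hu]
    refine mul_le_mul_of_nonneg_left (not_lt.1 fun hlt => ?_) (hw u)
    obtain ⟨hju, hiu⟩ := cutRay_apply_lt_iff.1 hlt
    rcases hflag.total (Set.mem_image_of_mem _ hv)
      (Set.mem_image_of_mem _ (mem_carrierFace.2 hu)) with hsub | hsub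
    · exact hiu (hsub hiv)
    · exact hjv (hsub hju)

theorem initials_rayCombination (hw : 0 ≤ w) (hflag : IsFlag (carrierFace w)) :
    initials (rayCombination w) = carrierFace w :=
  initials_eq_of_lt_iff fun _ _ => rayCombination_apply_lt_iff hw hflag

theorem eq_zero_of_rayCombination_eq_zero (hflag : IsFlag (carrierFace w))
    (h0 : rayCombination w = 0) : w = 0 := by
  by_contra hw
  obtain ⟨u, hu⟩ := Function.ne_iff.1 hw
  obtain ⟨m, -, hmax⟩ := Finset.univ.exists_max_image (fun v => |w v|) ⟨u, Finset.mem_univ u⟩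
  have hm : w m ≠ 0 := fun h =>
    hu (abs_nonpos_iff.1 ((hmax u (Finset.mem_univ u)).trans_eq (by rw [h, abs_zero])))
  -- Moving from the indicator of the support along the relation `w` until the coefficient of `m`
  -- vanishes changes the support but not the combination.
  let c : TwoBlock n → ℝ := fun v => if w v = 0 then 0 else 1
  let c' : TwoBlock n → ℝ := c - (w m)⁻¹ • w
  have hc : carrierFace c = carrierFace w := by ext v; simp [mem_carrierFace, c]
  have hc' : carrierFace c' ⊆ carrierFace w := fun v hv => mem_carrierFace.2 fun h =>
    mem_carrierFace.1 hv (by simp [c', c, h])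
  have hc0 : 0 ≤ c := fun v => by by_cases h : w v = 0 <;> simp [c, h]
  have hc'0 : 0 ≤ c' := fun v => by
    rcases eq_or_ne (w v) 0 with hv | hv
    · simp [c', c, hv]
    · have hle : w v / w m ≤ 1 := (le_abs_self _).trans (by
        rw [abs_div]
        exact div_le_one_of_le₀ (hmax v (Finset.mem_univ v)) (abs_nonneg _))
      simpa [c', c, hv, inv_mul_eq_div] using hle
  have hcomb : rayCombination c' = rayCombination c := by simp [c', h0]
  have hsupport : carrierFace c' = carrierFace w := by
    rw [← initials_rayCombination hc'0 (hflag.mono hc'), hcomb,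
      initials_rayCombination hc0 (hc ▸ hflag), hc]
  have hmem : m ∈ carrierFace c' := hsupport ▸ mem_carrierFace.2 hm
  exact mem_carrierFace.1 hmem (by simp [c', c, hm])

theorem OrderedSetPartition.IsFlag.linearIndepOn_cutRay {s : Finset (TwoBlock n)}
    (hs : IsFlag s) : LinearIndepOn ℝ cutRay (s : Set (TwoBlock n)) := by
  refine linearIndepOn_iff.2 fun c hc h0 => DFunLike.coe_injective ?_
  refine eq_zero_of_rayCombination_eq_zero (hs.mono fun v hv => ?_) ?_
  · exact hc (Finsupp.mem_support_iff.2 (mem_carrierFace.1 hv))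
  · rw [← h0, rayCombination, Fintype.linearCombination_apply, Finsupp.linearCombination_apply,
      Finsupp.sum_fintype _ _ fun v => zero_smul ℝ (cutRay v)]

theorem rayCombination_injOn :
    Set.InjOn rayCombination {w : TwoBlock n → ℝ | 0 ≤ w ∧ IsFlag (carrierFace w)} := by
  rintro w ⟨hw, hflag⟩ w' ⟨hw', hflag'⟩ h
  have hsupport : carrierFace w = carrierFace w' := by
    rw [← initials_rayCombination hw hflag, h, initials_rayCombination hw' hflag']
  refine sub_eq_zero.1 (eq_zero_of_rayCombination_eq_zero (hflag.mono fun v hv => ?_)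
    (by rw [map_sub, h, sub_self]))
  by_contra hvw
  have hvw' : v ∉ carrierFace w' := hsupport ▸ hvw
  simp only [mem_carrierFace, not_not] at hvw hvw'
  exact mem_carrierFace.1 hv (by simp [hvw, hvw'])

theorem exists_initials_sub_smul_cutRay_subset {x : EuclideanSpace ℝ (Fin n)}
    (hv : v ∈ initials x) :
    ∃ a : ℝ, 0 ≤ a ∧ initials (x - a • cutRay v) ⊆ (initials x).erase v := by
  obtain ⟨i₀, hi₀, j₀, hj₀, hmax, hmin⟩ := exists_isMax_firstBlock_isMin_compl v x
  have hray : 0 < cutRay v j₀ - cutRay v i₀ := sub_pos.2 (cutRay_apply_lt_iff.2 ⟨hi₀, hj₀⟩)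
  -- This multiple of the ray closes the gap between the two blocks of `v`.
  let a := (x j₀ - x i₀) / (cutRay v j₀ - cutRay v i₀)
  have ha : 0 ≤ a := div_nonneg (sub_nonneg.2 (mem_initials.1 hv i₀ hi₀ j₀ hj₀).le) hray.le
  set y := x - a • cutRay v with hy
  have hyk : ∀ k, y k = x k - a * cutRay v k := fun k => by simp [hy]
  have hgap : y i₀ = y j₀ := by
    have := div_mul_cancel₀ (x j₀ - x i₀) hray.ne'
    rw [hyk, hyk]
    linarith
  have hcross : ∀ i ∉ firstBlock v, ∀ j ∈ firstBlock v, y j ≤ y i := fun i hi j hj => calc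
    y j ≤ y i₀ := by
      rw [hyk, hyk, cutRay_apply_congr (iff_of_true hj hi₀)]
      exact sub_le_sub_right (hmax j hj) _
    _ = y j₀ := hgap
    _ ≤ y i := by
      rw [hyk, hyk, cutRay_apply_congr (iff_of_false hi hj₀)]
      exact sub_le_sub_right (hmin i hi) _
  refine ⟨a, ha, fun u hu => Finset.mem_erase.2 ⟨?_, mem_initials.2 fun i hi j hj => ?_⟩⟩
  · rintro rfl
    exact (mem_initials.1 hu i₀ hi₀ j₀ hj₀).ne hgap
  · have hlt : y i < y j := mem_initials.1 hu i hi j hj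
    have hle : cutRay v i ≤ cutRay v j := not_lt.1 fun h =>
      (hcross i (cutRay_apply_lt_iff.1 h).2 j (cutRay_apply_lt_iff.1 h).1).not_gt hlt
    have := mul_le_mul_of_nonneg_left hle ha
    rw [hyk, hyk] at hlt
    linarith

theorem exists_rayCombination_eq {x : EuclideanSpace ℝ (Fin n)} (hx : x ∈ sumZeroHyperplane n) :
    ∃ w : TwoBlock n → ℝ, 0 ≤ w ∧ carrierFace w = initials x ∧ rayCombination w = x := by
  suffices h : ∃ w : TwoBlock n → ℝ, 0 ≤ w ∧ carrierFace w ⊆ initials x ∧ rayCombination w = x by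
    obtain ⟨w, hw, hsub, rfl⟩ := h
    exact ⟨w, hw, (initials_rayCombination hw ((isFlag_initials _).mono hsub)).symm, rfl⟩
  induction hs : initials x using Finset.strongInduction generalizing x with
  | H s ih =>
  rcases eq_or_ne x 0 with rfl | h0
  · exact ⟨0, le_rfl, fun v hv => (mem_carrierFace.1 hv rfl).elim, map_zero _⟩
  obtain ⟨v, hv⟩ := initials_nonempty hx h0
  obtain ⟨a, ha, hsub⟩ := exists_initials_sub_smul_cutRay_subset hv
  obtain ⟨w, hw, hws, hwx⟩ := ih _ (hs ▸ hsub.trans_ssubset (Finset.erase_ssubset hv))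
    (Submodule.sub_mem _ hx (Submodule.smul_mem _ a (cutRay_mem_sumZeroSphere v).1)) rfl
  refine ⟨w + Pi.single v a, add_nonneg hw (Pi.single_nonneg.2 ha), fun u hu => ?_, ?_⟩
  · by_contra hus
    have huv : u ≠ v := fun h => hus (h ▸ hs ▸ hv)
    have hwu : w u = 0 := not_not.1 fun h =>
      hus (hs ▸ Finset.mem_of_mem_erase (hsub (hws (mem_carrierFace.2 h))))
    exact mem_carrierFace.1 hu (by simp [hwu, huv])
  · rw [map_add, hwx, rayCombination_single, sub_add_cancel]

end Rays

/-! ### Cells of the braid subdivision -/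

section Cells

variable {n : ℕ} {s : Finset (TwoBlock n)} {x y : EuclideanSpace ℝ (Fin n)}

theorem OrderedSetPartition.IsFlag.mem_sphericalHull_map_iff (hs : IsFlag s) :
    y ∈ sphericalHull (s.map (cutRayEmbedding n)) ↔ y ∈ sumZeroSphere n ∧ initials y ⊆ s := by
  refine and_congr_right fun hy => ⟨?_, fun hys => ?_⟩
  · rintro ⟨c, hc, hyc⟩
    rw [Finset.sum_map] at hyc
    let w : TwoBlock n → ℝ := fun v => if v ∈ s then c (cutRay v) else 0
    have hw : 0 ≤ w := fun v => by
      by_cases hv : v ∈ s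
      · simpa [w, hv, cutRayEmbedding] using hc _ (Finset.mem_map_of_mem (cutRayEmbedding n) hv)
      · simp [w, hv]
    have hws : carrierFace w ⊆ s := fun v hv =>
      by_contra fun h => mem_carrierFace.1 hv (by simp [w, h])
    have hyw : y = rayCombination w := by
      rw [hyc, rayCombination_eq_sum hws]
      exact Finset.sum_congr rfl fun v hv => by simp [w, hv, cutRayEmbedding]
    rwa [hyw, initials_rayCombination hw (hs.mono hws)]
  · obtain ⟨w, hw, hwy, rfl⟩ := exists_rayCombination_eq hy.1
    have hextend : ∀ v, Function.extend cutRay w 0 (cutRay v) = w v :=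
      cutRay_injective.extend_apply w 0
    refine ⟨Function.extend cutRay w 0, fun z hz => ?_, ?_⟩
    · obtain ⟨v, -, rfl⟩ := Finset.mem_map.1 hz
      exact (hw v).trans_eq (hextend v).symm
    · rw [rayCombination_eq_sum (hwy.trans_subset hys), Finset.sum_map]
      exact Finset.sum_congr rfl fun v _ => by rw [cutRayEmbedding, Function.Embedding.coeFn_mk,
        hextend]

theorem isSphericalSimplex_braidFace_inter (hx : x ∈ sumZeroSphere n) :
    IsSphericalSimplex ((initials x).map (cutRayEmbedding n)) (braidFace x ∩ sumZeroSphere n) := by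
  refine ⟨(initials_nonempty hx.1 (ne_zero_of_mem_sumZeroSphere hx)).map, fun z hz => ?_, ?_, ?_⟩
  · obtain ⟨v, -, rfl⟩ := Finset.mem_map.1 hz
    exact cutRay_mem_sumZeroSphere v
  · rw [Finset.coe_map]
    exact (isFlag_initials x).linearIndepOn_cutRay.id_image
  · ext y
    rw [(isFlag_initials x).mem_sphericalHull_map_iff, Set.mem_inter_iff, mem_braidFace_iff,
      and_comm]

theorem OrderedSetPartition.IsFlag.exists_initials_eq (hs : IsFlag s) (hne : s.Nonempty) :
    ∃ x ∈ sumZeroSphere n, initials x = s := by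
  let w : TwoBlock n → ℝ := fun v => if v ∈ s then 1 else 0
  have hw : 0 ≤ w := fun v => by by_cases hv : v ∈ s <;> simp [w, hv]
  have hws : carrierFace w = s := by ext v; simp [mem_carrierFace, w]
  have h0 : rayCombination w ≠ 0 := fun h => by
    obtain ⟨v, hv⟩ := hne
    rw [← hws, mem_carrierFace, eq_zero_of_rayCombination_eq_zero (hws ▸ hs) h] at hv
    exact hv rfl
  exact ⟨_, normalize_mem_sumZeroSphere (rayCombination_mem_sumZeroHyperplane w) h0, by
    rw [initials_normalize, initials_rayCombination hw (hws ▸ hs), hws]⟩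

end Cells

/-! ### Faces of the complexes -/

section Faces

variable {n : ℕ} {H : Hypergraph (Fin n)}

theorem mem_partitionComplex {I : LowerSet (OrderedSetPartition n)} {s : Finset (TwoBlock n)} :
    s ∈ (partitionComplex I).faces ↔ s.Nonempty ∧ ∃ B ∈ I, initials B.blockIndex = s := by
  simp only [partitionComplex, Set.mem_ofPred_eq, le_iff_mem_initials_blockIndex, Finset.ext_iff,
    iff_comm]

theorem OrderedSetPartition.IsFlag.exists_initials_blockIndex_eq {s : Finset (TwoBlock n)}
    (hs : IsFlag s) (hne : s.Nonempty) :
    ∃ B : OrderedSetPartition n, initials B.blockIndex = s := by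
  obtain ⟨x, -, rfl⟩ := hs.exists_initials_eq hne
  exact ⟨ofFun x, initials_blockIndex_ofFun⟩

theorem mem_orderedPartitionComplex {s : Finset (TwoBlock n)} :
    s ∈ (orderedPartitionComplex n).faces ↔ s.Nonempty ∧ IsFlag s := by
  rw [orderedPartitionComplex, mem_partitionComplex]
  refine and_congr_right fun hne => ⟨?_, fun hs => ?_⟩
  · rintro ⟨B, -, rfl⟩
    exact isFlag_initials _
  · obtain ⟨B, hB⟩ := hs.exists_initials_blockIndex_eq hne
    exact ⟨B, trivial, hB⟩

theorem mem_coloringComplex {s : Finset (TwoBlock n)} :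
    s ∈ (coloringComplex H).faces ↔
      s.Nonempty ∧ IsFlag s ∧ ∃ e ∈ H.edgeSet, ∀ v ∈ s, ¬Separates v e := by
  rw [coloringComplex, mem_partitionComplex]
  refine and_congr_right fun hne => ?_
  have : Nonempty (Fin n) := hne.elim fun v _ => (firstBlock_nonempty v).to_type
  have hmem : ∀ B, B ∈ coloringIdeal H ↔
      ∃ e ∈ H.edgeSet, ∀ v ∈ initials B.blockIndex, ¬Separates v e := fun B => by
    simp only [← forall_eq_iff_forall_not_separates, ← exists_block_superset_iff]
    exact ⟨fun ⟨b, hb, e, he, heb⟩ => ⟨e, he, b, hb, heb⟩,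
      fun ⟨e, he, b, hb, heb⟩ => ⟨b, hb, e, he, heb⟩⟩
  constructor
  · rintro ⟨B, hB, rfl⟩
    exact ⟨isFlag_initials _, (hmem B).1 hB⟩
  · rintro ⟨hs, he⟩
    obtain ⟨B, rfl⟩ := hs.exists_initials_blockIndex_eq hne
    exact ⟨B, (hmem B).2 he, rfl⟩

theorem coloringComplex_le_orderedPartitionComplex (H : Hypergraph (Fin n)) :
    coloringComplex H ≤ orderedPartitionComplex n := fun _ hs =>
  mem_orderedPartitionComplex.2 ⟨(mem_coloringComplex.1 hs).1, (mem_coloringComplex.1 hs).2.1⟩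

theorem coloringComplex_le_completeGraph (hH : ∀ e ∈ H.edgeSet, 2 ≤ e.ncard) :
    coloringComplex H ≤ coloringComplex (completeGraphHypergraph n) := fun s hs => by
  obtain ⟨hne, hflag, e, he, hsep⟩ := mem_coloringComplex.1 hs
  obtain ⟨d, hde, hd⟩ := Set.exists_subset_card_eq (hH e he)
  refine mem_coloringComplex.2 ⟨hne, hflag, d, hd, fun v hv => ?_⟩
  rintro ⟨i, hi, j, hj, hij⟩
  exact hsep v hv ⟨i, hde hi, j, hde hj, hij⟩

theorem orderedPartitionComplex_iso_sdBoundarySimplex (n : ℕ) :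
    SimpliciallyIsomorphic (orderedPartitionComplex n) (sdBoundarySimplex n) := by
  refine .of_embedding ⟨firstBlock, firstBlock_injective⟩ (fun s => ?_) fun A hA => ?_
  · have hproper : ∀ A ∈ s.map ⟨firstBlock, firstBlock_injective⟩,
        A.Nonempty ∧ A ≠ Finset.univ := fun A hA => by
      obtain ⟨v, -, rfl⟩ := Finset.mem_map.1 hA
      exact ⟨firstBlock_nonempty v,
        mt (Finset.compl_eq_empty_iff _).2 (compl_firstBlock_nonempty v).ne_empty⟩
    simp only [mem_orderedPartitionComplex, sdBoundarySimplex, Set.mem_ofPred_eq,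
      Finset.map_nonempty, and_iff_right hproper, Finset.coe_map, Function.Embedding.coeFn_mk,
      IsFlag]
  · obtain ⟨hne, huniv⟩ := hA.2.1 A (Finset.mem_singleton_self A)
    exact exists_firstBlock_eq hne
      (Finset.nonempty_iff_ne_empty.2 (mt (Finset.compl_eq_empty_iff A).1 huniv))

variable {x y : EuclideanSpace ℝ (Fin n)}

theorem mem_hypergraphArrangement_iff_not_separates (hx : x ∈ sumZeroHyperplane n) :
    x ∈ hypergraphArrangement H ↔ ∃ e ∈ H.edgeSet, ∀ v ∈ initials x, ¬Separates v e := by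
  simp only [mem_hypergraphArrangement, hx, true_and, forall_eq_iff_forall_not_separates]

theorem initials_mem_coloringComplex_iff (hx : x ∈ sumZeroSphere n) :
    initials x ∈ (coloringComplex H).faces ↔ x ∈ hypergraphArrangement H := by
  rw [mem_coloringComplex, mem_hypergraphArrangement_iff_not_separates hx.1,
    and_iff_right (initials_nonempty hx.1 (ne_zero_of_mem_sumZeroSphere hx)),
    and_iff_right (isFlag_initials x)]

theorem braidFace_inter_subset_hypergraphArrangement (hx : x ∈ hypergraphArrangement H) :
    braidFace x ∩ sumZeroSphere n ⊆ hypergraphArrangement H := by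
  rintro y ⟨hyx, hy⟩
  obtain ⟨e, he, hsep⟩ :=
    (mem_hypergraphArrangement_iff_not_separates (mem_hypergraphArrangement.1 hx).1).1 hx
  exact (mem_hypergraphArrangement_iff_not_separates hy.1).2
    ⟨e, he, fun v hv => hsep v (mem_braidFace_iff.1 hyx hv)⟩

theorem mem_coloringComplex_iff_exists_initials_eq {s : Finset (TwoBlock n)} :
    s ∈ (coloringComplex H).faces ↔
      ∃ x ∈ sumZeroSphere n, x ∈ hypergraphArrangement H ∧ initials x = s := by
  constructor
  · intro hs
    obtain ⟨hne, hflag⟩ :=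
      mem_orderedPartitionComplex.1 (coloringComplex_le_orderedPartitionComplex H hs)
    obtain ⟨x, hx, rfl⟩ := hflag.exists_initials_eq hne
    exact ⟨x, hx, (initials_mem_coloringComplex_iff hx).1 hs, rfl⟩
  · rintro ⟨x, hx, hxH, rfl⟩
    exact (initials_mem_coloringComplex_iff hx).2 hxH

theorem mem_restrictedBraidComplex_iff_exists_map_initials_eq
    {t : Finset (EuclideanSpace ℝ (Fin n))} :
    t ∈ (restrictedBraidComplex (hypergraphArrangement H)).faces ↔
      ∃ x ∈ sumZeroSphere n, x ∈ hypergraphArrangement H ∧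
        (initials x).map (cutRayEmbedding n) = t := by
  constructor
  · rintro ⟨_, ⟨⟨x, hx, rfl⟩, hxH⟩, ht⟩
    exact ⟨x, hx, hxH ⟨mem_braidFace_iff.2 subset_rfl, hx⟩,
      (isSphericalSimplex_braidFace_inter hx).vertices_unique ht⟩
  · rintro ⟨x, hx, hxH, rfl⟩
    exact ⟨_, ⟨⟨x, hx, rfl⟩, braidFace_inter_subset_hypergraphArrangement hxH⟩,
      isSphericalSimplex_braidFace_inter hx⟩

theorem coloringComplex_iso_restrictedBraidComplex (H : Hypergraph (Fin n)) :
    SimpliciallyIsomorphic (coloringComplex H)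
      (restrictedBraidComplex (hypergraphArrangement H)) := by
  refine .of_embedding (cutRayEmbedding n) (fun s => ?_) fun u hu => ?_
  · simp only [mem_coloringComplex_iff_exists_initials_eq,
      mem_restrictedBraidComplex_iff_exists_map_initials_eq, Finset.map_inj]
  · obtain ⟨x, -, -, hx⟩ := mem_restrictedBraidComplex_iff_exists_map_initials_eq.1 hu
    obtain ⟨v, -, hv⟩ := Finset.mem_map.1 (hx ▸ Finset.mem_singleton_self u)
    exact ⟨v, hv⟩

end Faces

/-! ### The homeomorphism with the sphere -/

section Sphere

variable {n : ℕ}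

theorem rayCombination_ne_zero {w : TwoBlock n → ℝ}
    (hw : w ∈ geometricRealization (orderedPartitionComplex n)) : rayCombination w ≠ 0 := by
  obtain ⟨-, hsum, hface⟩ := mem_geometricRealization.1 hw
  rintro h0
  rw [eq_zero_of_rayCombination_eq_zero (mem_orderedPartitionComplex.1 hface).2 h0] at hsum
  simp at hsum

/-- The radial projection of the realization of the complex of ordered set partitions, whose
vertices are placed at the rays of the braid arrangement, to the sphere. -/
noncomputable def toSphere (w : geometricRealization (orderedPartitionComplex n)) :
    sumZeroSphere n :=
  ⟨normalize (rayCombination w.1), normalize_mem_sumZeroSphere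
    (rayCombination_mem_sumZeroHyperplane _) (rayCombination_ne_zero w.2)⟩

theorem initials_toSphere (w : geometricRealization (orderedPartitionComplex n)) :
    initials (toSphere w).1 = carrierFace w.1 := by
  obtain ⟨hw, -, hface⟩ := mem_geometricRealization.1 w.2
  rw [toSphere, initials_normalize,
    initials_rayCombination hw (mem_orderedPartitionComplex.1 hface).2]

theorem continuous_toSphere : Continuous (toSphere (n := n)) := by
  have hcont : Continuous fun w : geometricRealization (orderedPartitionComplex n) =>
      rayCombination w.1 :=
    (LinearMap.continuous_of_finiteDimensional _).comp continuous_subtype_val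
  exact ((hcont.norm.inv₀ fun w => norm_ne_zero_iff.2 (rayCombination_ne_zero w.2)).smul
    hcont).subtype_mk _

theorem toSphere_injective : Function.Injective (toSphere (n := n)) := by
  rintro ⟨w, hw⟩ ⟨w', hw'⟩ h
  obtain ⟨hw0, hsum, hface⟩ := mem_geometricRealization.1 hw
  obtain ⟨hw0', hsum', hface'⟩ := mem_geometricRealization.1 hw'
  have hr := inv_pos.2 (norm_pos_iff.2 (rayCombination_ne_zero hw))
  have hr' := inv_pos.2 (norm_pos_iff.2 (rayCombination_ne_zero hw'))
  set r := ‖rayCombination w‖⁻¹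
  set r' := ‖rayCombination w'‖⁻¹
  have hscaled : r • w = r' • w' := by
    refine rayCombination_injOn ⟨smul_nonneg hr.le hw0, ?_⟩ ⟨smul_nonneg hr'.le hw0', ?_⟩ ?_
    · exact carrierFace_smul hr.ne' w ▸ (mem_orderedPartitionComplex.1 hface).2
    · exact carrierFace_smul hr'.ne' w' ▸ (mem_orderedPartitionComplex.1 hface').2
    · rw [map_smul, map_smul]
      exact congrArg Subtype.val h
  have hrr' : r = r' := by
    have := congrArg (fun c : TwoBlock n → ℝ => ∑ v, c v) hscaled
    simpa [← Finset.mul_sum, hsum, hsum'] using this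
  rw [← hrr'] at hscaled
  exact Subtype.ext (smul_right_injective _ hr.ne' hscaled)

theorem toSphere_surjective : Function.Surjective (toSphere (n := n)) := by
  rintro ⟨u, hu⟩
  obtain ⟨w, hw, hsupport, hwu⟩ := exists_rayCombination_eq hu.1
  have hne : (carrierFace w).Nonempty :=
    hsupport ▸ initials_nonempty hu.1 (ne_zero_of_mem_sumZeroSphere hu)
  have hpos : 0 < ∑ v, w v := by
    rw [← sum_carrierFace]
    exact Finset.sum_pos (fun v hv => (hw v).lt_of_ne' (mem_carrierFace.1 hv)) hne
  refine ⟨⟨(∑ v, w v)⁻¹ • w, mem_geometricRealization.2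
    ⟨smul_nonneg (inv_pos.2 hpos).le hw, ?_, ?_⟩⟩, Subtype.ext ?_⟩
  · simp only [Pi.smul_apply, smul_eq_mul, ← Finset.mul_sum, inv_mul_cancel₀ hpos.ne']
  · rw [carrierFace_smul (inv_pos.2 hpos).ne']
    exact mem_orderedPartitionComplex.2 ⟨hne, hsupport ▸ isFlag_initials _⟩
  · change normalize (rayCombination ((∑ v, w v)⁻¹ • w)) = u
    rw [map_smul, hwu, normalize_smul_of_pos (inv_pos.2 hpos),
      normalize_eq_self_of_norm_eq_one hu.2]

/-- The homeomorphism with the sphere given by the radial projection `toSphere`. -/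
noncomputable def sphereHomeomorph (n : ℕ) :
    geometricRealization (orderedPartitionComplex n) ≃ₜ sumZeroSphere n :=
  haveI : CompactSpace (geometricRealization (orderedPartitionComplex n)) :=
    isCompact_iff_compactSpace.1 (isCompact_geometricRealization (Set.toFinite _))
  Continuous.homeoOfEquivCompactToT2
    (f := Equiv.ofBijective toSphere ⟨toSphere_injective, toSphere_surjective⟩) continuous_toSphere

theorem sphereHomeomorph_image_coloringComplex (H : Hypergraph (Fin n)) :
    sphereHomeomorph n '' {p | p.1 ∈ geometricRealization (coloringComplex H)} =
      {u | u.1 ∈ hypergraphArrangement H} := by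
  have hpre : {p : geometricRealization (orderedPartitionComplex n) |
      p.1 ∈ geometricRealization (coloringComplex H)} =
        sphereHomeomorph n ⁻¹' {u | u.1 ∈ hypergraphArrangement H} := by
    ext p
    obtain ⟨hp, hsum, -⟩ := mem_geometricRealization.1 p.2
    change p.1 ∈ geometricRealization (coloringComplex H) ↔
      (toSphere p).1 ∈ hypergraphArrangement H
    rw [mem_geometricRealization, and_iff_right hp, and_iff_right hsum, ← initials_toSphere,
      initials_mem_coloringComplex_iff (toSphere p).2]
  rw [hpre, Set.image_preimage_eq _ (sphereHomeomorph n).surjective]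

end Sphere

theorem mainTheorem4_general (n : ℕ) :
    (∀ H : Hypergraph (Fin n),
      (∀ C ∈ restrictedBraidCells (hypergraphArrangement H), ∃ s, IsSphericalSimplex s C) ∧
      SimpliciallyIsomorphic (coloringComplex H)
        (restrictedBraidComplex (hypergraphArrangement H))) ∧
    SimpliciallyIsomorphic (orderedPartitionComplex n) (sdBoundarySimplex n) ∧
    (∀ H : Hypergraph (Fin n), (∀ e ∈ H.edgeSet, 2 ≤ e.ncard) →
      coloringComplex H ≤ coloringComplex (completeGraphHypergraph n)) ∧
    (∀ H : Hypergraph (Fin n), coloringComplex H ≤ orderedPartitionComplex n) ∧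
    ∃ Φ : geometricRealization (orderedPartitionComplex n) ≃ₜ sumZeroSphere n,
      ∀ H : Hypergraph (Fin n), Φ '' {p | p.1 ∈ geometricRealization (coloringComplex H)} =
        {u | u.1 ∈ hypergraphArrangement H} := by
  refine ⟨fun H => ⟨?_, coloringComplex_iso_restrictedBraidComplex H⟩,
    orderedPartitionComplex_iso_sdBoundarySimplex n, fun _ => coloringComplex_le_completeGraph,
    coloringComplex_le_orderedPartitionComplex,
    sphereHomeomorph n, sphereHomeomorph_image_coloringComplex⟩
  rintro _ ⟨⟨x, hx, rfl⟩, -⟩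
  exact ⟨_, isSphericalSimplex_braidFace_inter hx⟩

theorem mainTheorem4 {n : ℕ} (H : Hypergraph (Fin n))
    (hV : H.vertexSet = Set.univ)
    (hloop : ∀ e ∈ H.edgeSet, 2 ≤ e.ncard)
    (hanti : IsAntichain (· ⊆ ·) H.edgeSet) :
    -- every cell of the restriction of the braid subdivision is a spherical simplex, and the
    -- resulting simplicial complex is isomorphic to the coloring complex
    ((∀ C ∈ restrictedBraidCells (hypergraphArrangement H), ∃ s, IsSphericalSimplex s C) ∧
      SimpliciallyIsomorphic (coloringComplex H)
        (restrictedBraidComplex (hypergraphArrangement H))) ∧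
    -- the coloring complexes are subcomplexes of the complex of all ordered set partitions, which
    -- is the barycentric subdivision of the boundary of a simplex
    (SimpliciallyIsomorphic (orderedPartitionComplex n) (sdBoundarySimplex n) ∧
      coloringComplex H ≤ coloringComplex (completeGraphHypergraph n) ∧
      coloringComplex (completeGraphHypergraph n) ≤ orderedPartitionComplex n) ∧
    -- homeomorphism with the sphere that matches the subcomplexes with the arrangements
    ∃ Φ : geometricRealization (orderedPartitionComplex n) ≃ₜ sumZeroSphere n,
      Φ '' {p | p.1 ∈ geometricRealization (coloringComplex H)} =
          {u | u.1 ∈ hypergraphArrangement H} ∧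
      Φ '' {p | p.1 ∈ geometricRealization (coloringComplex (completeGraphHypergraph n))} =
          {u | u.1 ∈ hypergraphArrangement (completeGraphHypergraph n)} := by
  obtain ⟨hcells, hiso, hcomplete, hordered, Φ, hΦ⟩ := mainTheorem4_general n
  exact ⟨hcells H, ⟨hiso, hcomplete H hloop, hordered _⟩, Φ, hΦ _, hΦ _⟩
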